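/- Let $\mathbb K=\mathbb R$ or $\mathbb K=\mathbb C$, let $n\ge 0$, let $A_{-1}\in\mathbb K^{n\times n}$, and let $A_2,A_3$ be $n\times n$ matrix functions on $[-1,0]$ with entries in $L_2(-1,0;\mathbb K)$. Put $M_2=\mathbb K^n\times L_2(-1,0;\mathbb K^n)$ and $H^1=H^1([-1,0];\mathbb K^n)$; functions in $H^1$ are identified with their continuous representatives. Let $\tilde{\mathcal A}$ be the operator in $M_2$ whose domain $D(\tilde{\mathcal A})$ consists of the pairs $(w,\psi)\in M_2$ such that $r:=\psi+A_2(\cdot)w\in H^1$ and $r(-1)=A_{-1}r(0)$, and which acts by $$\tilde{\mathcal A}(w,\psi)=\bigl(r(0),\,-r'+A_3(\cdot)w\bigr).$$ Let $D(\mathcal A)=\{(v,z)\in M_2: z\in H^1,\ v=z(0)-A_{-1}z(-1)\}$, and let $F:D(\mathcal A)\to M_2$ be the operator $F(v,z)=(w(0),\psi)$, where $w(s)=z(s-1)$ for $0\le s\le 1$ and, for almost every $\theta\in[-1,0]$, $$\psi(\theta)+A_2(\theta)w(0)=\dot w(-\theta)+\int_0^\theta\bigl[A_2(\tau)\dot w(\tau-\theta)+A_3(\tau)w(\tau-\theta)\bigr]\,d\tau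 .$$ Let $\lambda\in\mathbb K$ with $\lambda\notin\sigma(\tilde{\mathcal A})$, i.e. $\lambda I-\tilde{\mathcal A}:D(\tilde{\mathcal A})\to M_2$ is bijective with bounded inverse. Then $F:D(\mathcal A)\to M_2$ is bijective, and the operator $F^{-1}(\lambda I-\tilde{\mathcal A})$, defined on $D(\tilde{\mathcal A})$, extends to a bounded and boundedly invertible operator from $M_2$ to $M_2$ (with respect to the norm of $M_2$). -/

import Mathlib

open MeasureTheory Set

noncomputable section

namespace NeutralSystem

/-- The finite-dimensional space `𝕜ⁿ` with its Euclidean norm (`𝕜 = ℝ` or `𝕜 = ℂ`). -/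
abbrev E (𝕜 : Type*) (n : ℕ) : Type _ := EuclideanSpace 𝕜 (Fin n)

/-- Lebesgue measure on `[-1, 0]`. -/
abbrev μ : Measure ℝ := volume.restrict (Icc (-1 : ℝ) 0)

/-- The space `L₂(-1, 0; 𝕜ⁿ)`. -/
abbrev L2 (𝕜 : Type*) [RCLike 𝕜] (n : ℕ) : Type _ := Lp (E 𝕜 n) 2 μ

/-- The Hilbert space `M₂ = 𝕜ⁿ × L₂(-1, 0; 𝕜ⁿ)`, with norm `(‖v‖² + ‖φ‖²)^{1/2}`. -/
abbrev M2 (𝕜 : Type*) [RCLike 𝕜] (n : ℕ) : Type _ := WithLp 2 (E 𝕜 n × L2 𝕜 n)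

/-- The coefficients of the neutral type system
`z'(t) = A₋₁ z'(t-1) + ∫_{-1}^0 [A₂(θ) z'(t+θ) + A₃(θ) z(t+θ)] dθ`: a constant matrix `A₋₁` and
two matrix functions on `[-1, 0]` whose elements belong to `L₂(-1, 0)`. -/
structure Coeffs (𝕜 : Type*) [RCLike 𝕜] (n : ℕ) where
  Am1 : Matrix (Fin n) (Fin n) 𝕜
  A2 : ℝ → Matrix (Fin n) (Fin n) 𝕜
  A3 : ℝ → Matrix (Fin n) (Fin n) 𝕜
  memLp_A2 : ∀ i j, MemLp (fun θ => A2 θ i j) 2 μ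
  memLp_A3 : ∀ i j, MemLp (fun θ => A3 θ i j) 2 μ

variable {𝕜 : Type*} [RCLike 𝕜] {n : ℕ}

/-- The action `v ↦ M v` of a matrix on `𝕜ⁿ`, as a continuous linear map. -/
def act (M : Matrix (Fin n) (Fin n) 𝕜) : E 𝕜 n →L[𝕜] E 𝕜 n := Matrix.toEuclideanCLM (𝕜 := 𝕜) M

theorem act_apply (M : Matrix (Fin n) (Fin n) 𝕜) (v : E 𝕜 n) :
    act M v = WithLp.toLp 2 (M.mulVec v) := rfl

theorem act_eq_sum (M : Matrix (Fin n) (Fin n) 𝕜) :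
    act M = ∑ i, ∑ j, M i j • act (Matrix.single i j (1 : 𝕜)) := by
  conv_lhs => rw [Matrix.matrix_eq_sum_single M]
  simp only [act, map_sum]
  refine Finset.sum_congr rfl fun i _ => Finset.sum_congr rfl fun j _ => ?_
  rw [← map_smul]
  simp [Matrix.smul_single]

theorem memLp_sum_smul {G : Type*} [NormedAddCommGroup G] [NormedSpace 𝕜 G]
    {b : Fin n → Fin n → ℝ → 𝕜} (hb : ∀ i j, MemLp (b i j) 2 μ) (c : Fin n → Fin n → G) :
    MemLp (fun θ => ∑ i, ∑ j, b i j θ • c i j) 2 μ :=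
  memLp_finsetSum _ fun i _ => memLp_finsetSum _ fun j _ =>
    (ContinuousLinearMap.toSpanSingleton 𝕜 (c i j)).comp_memLp' (hb i j)

theorem memLp_act {B : ℝ → Matrix (Fin n) (Fin n) 𝕜} (hB : ∀ i j, MemLp (fun θ => B θ i j) 2 μ) :
    MemLp (fun θ => act (B θ)) 2 μ := by
  have h3 : (fun θ => act (B θ)) = fun θ => ∑ i, ∑ j, B θ i j • act (Matrix.single i j (1 : 𝕜)) :=
    funext fun θ => act_eq_sum (B θ)
  rw [h3]
  exact memLp_sum_smul hB fun i j => act (Matrix.single i j (1 : 𝕜))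

theorem memLp_act_const {B : ℝ → Matrix (Fin n) (Fin n) 𝕜}
    (hB : ∀ i j, MemLp (fun θ => B θ i j) 2 μ) (w : E 𝕜 n) :
    MemLp (fun θ => act (B θ) w) 2 μ :=
  (ContinuousLinearMap.apply 𝕜 (E 𝕜 n) w).comp_memLp' (memLp_act hB)

/-- The map `w ↦ B(·) w` from `𝕜ⁿ` to `L₂(-1, 0; 𝕜ⁿ)`. -/
def mulVecL2 (B : ℝ → Matrix (Fin n) (Fin n) 𝕜) (hB : ∀ i j, MemLp (fun θ => B θ i j) 2 μ) :
    E 𝕜 n →ₗ[𝕜] L2 𝕜 n where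
  toFun w := (memLp_act_const hB w).toLp (fun θ => act (B θ) w)
  map_add' v w := by
    rw [← MemLp.toLp_add]
    exact MemLp.toLp_congr _ _ (.of_forall fun θ => by simp)
  map_smul' c w := by
    rw [RingHom.id_apply, ← MemLp.toLp_const_smul]
    exact MemLp.toLp_congr _ _ (.of_forall fun θ => by simp)

/-! ### The Sobolev space `H¹([-1, 0]; 𝕜ⁿ)` -/

theorem intervalIntegrable_L2 (g : L2 𝕜 n) {a b : ℝ} (ha : a ∈ Icc (-1 : ℝ) 0)
    (hb : b ∈ Icc (-1 : ℝ) 0) : IntervalIntegrable g volume a b := by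
  have h : IntegrableOn g (Icc (-1 : ℝ) 0) volume := (Lp.memLp g).integrable (by norm_num)
  exact (h.mono_set (uIcc_subset_Icc ha hb)).intervalIntegrable

/-- The absolutely continuous function `θ ↦ c + ∫_{-1}^θ g(s) ds` on `[-1, 0]`. -/
def prim (c : E 𝕜 n) (g : L2 𝕜 n) (θ : ℝ) : E 𝕜 n := c + ∫ s in (-1 : ℝ)..θ, g s

theorem continuousOn_prim (c : E 𝕜 n) (g : L2 𝕜 n) : ContinuousOn (prim c g) (Icc (-1 : ℝ) 0) := by
  have h : IntegrableOn g (Icc (-1 : ℝ) 0) volume := (Lp.memLp g).integrable (by norm_num)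
  have h' := intervalIntegral.continuousOn_primitive_interval (a := -1) (b := 0)
    (by rwa [uIcc_of_le (by norm_num)])
  rw [uIcc_of_le (by norm_num)] at h'
  exact continuousOn_const.add h'

theorem memLp_prim (c : E 𝕜 n) (g : L2 𝕜 n) : MemLp (prim c g) 2 μ := by
  obtain ⟨C, hC⟩ := isCompact_Icc.exists_bound_of_continuousOn (continuousOn_prim c g)
  exact MemLp.of_bound ((continuousOn_prim c g).aestronglyMeasurable measurableSet_Icc) C
    ((ae_restrict_iff' measurableSet_Icc).2 (.of_forall hC))

theorem prim_add {θ : ℝ} (hθ : θ ∈ Icc (-1 : ℝ) 0) (c c' : E 𝕜 n) (g g' : L2 𝕜 n) :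
    prim (c + c') (g + g') θ = prim c g θ + prim c' g' θ := by
  have h1 : (-1 : ℝ) ∈ Icc (-1 : ℝ) 0 := by norm_num
  have h : ∫ s in (-1 : ℝ)..θ, (g + g' : L2 𝕜 n) s = ∫ s in (-1 : ℝ)..θ, (g s + g' s) := by
    refine intervalIntegral.integral_congr_ae_restrict ?_
    have := Lp.coeFn_add g g'
    refine ae_restrict_of_ae_restrict_of_subset ?_ this
    rw [uIoc_of_le hθ.1]
    exact Ioc_subset_Icc_self.trans (Icc_subset_Icc le_rfl hθ.2)
  rw [prim, h, intervalIntegral.integral_add (intervalIntegrable_L2 g h1 hθ)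
    (intervalIntegrable_L2 g' h1 hθ), prim, prim]
  abel

theorem prim_smul {θ : ℝ} (hθ : θ ∈ Icc (-1 : ℝ) 0) (a : 𝕜) (c : E 𝕜 n) (g : L2 𝕜 n) :
    prim (a • c) (a • g) θ = a • prim c g θ := by
  have h : ∫ s in (-1 : ℝ)..θ, (a • g : L2 𝕜 n) s = ∫ s in (-1 : ℝ)..θ, a • g s := by
    refine intervalIntegral.integral_congr_ae_restrict ?_
    have := Lp.coeFn_smul a g
    refine ae_restrict_of_ae_restrict_of_subset ?_ this
    rw [uIoc_of_le hθ.1]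
    exact Ioc_subset_Icc_self.trans (Icc_subset_Icc le_rfl hθ.2)
  rw [prim, h, intervalIntegral.integral_smul, prim, smul_add]

/-- The map sending `(c, g)` to the class of `θ ↦ c + ∫_{-1}^θ g` in `L₂(-1, 0; 𝕜ⁿ)`. -/
def primL2 (𝕜 : Type*) [RCLike 𝕜] (n : ℕ) : (E 𝕜 n × L2 𝕜 n) →ₗ[𝕜] L2 𝕜 n where
  toFun p := (memLp_prim p.1 p.2).toLp (prim p.1 p.2)
  map_add' p q := by
    rw [← MemLp.toLp_add]
    exact MemLp.toLp_congr _ _ ((ae_restrict_iff' measurableSet_Icc).2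
      (.of_forall fun θ hθ => prim_add hθ _ _ _ _))
  map_smul' a p := by
    rw [RingHom.id_apply, ← MemLp.toLp_const_smul]
    exact MemLp.toLp_congr _ _ ((ae_restrict_iff' measurableSet_Icc).2
      (.of_forall fun θ hθ => prim_smul hθ _ _ _))

theorem primL2_injective : Function.Injective (primL2 𝕜 n) := by
  rw [injective_iff_map_eq_zero]
  rintro ⟨c, g⟩ h
  have h0 : prim c g =ᵐ[μ] fun _ => 0 := by
    have h1 := (memLp_prim c g).coeFn_toLp
    change (memLp_prim c g).toLp (prim c g) = 0 at h
    rw [h] at h1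
    exact h1.symm.trans (Lp.coeFn_zero _ _ _)
  have h1 : EqOn (prim c g) (fun _ => 0) (Icc (-1 : ℝ) 0) :=
    Measure.eqOn_Icc_of_ae_eq volume (by norm_num) h0 (continuousOn_prim c g) continuousOn_const
  have hc : c = 0 := by simpa [prim] using h1 (show (-1 : ℝ) ∈ Icc (-1 : ℝ) 0 by norm_num)
  subst hc
  have hi : IntervalIntegrable g volume (-1) 0 :=
    intervalIntegrable_L2 g (by norm_num) (by norm_num)
  have hg : (g : ℝ → E 𝕜 n) =ᵐ[μ] 0 := by
    have h2 := hi.ae_hasDerivAt_integral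
    rw [uIcc_of_le (by norm_num : (-1 : ℝ) ≤ 0)] at h2
    have h3 : ∀ᵐ x : ℝ, x ≠ -1 := by simp [ae_iff, measure_singleton]
    have h4 : ∀ᵐ x : ℝ, x ≠ 0 := by simp [ae_iff, measure_singleton]
    refine (ae_restrict_iff' measurableSet_Icc).2 ?_
    filter_upwards [h2, h3, h4] with x hx hx1 hx0 hxI
    have hd := hx hxI (-1) (by norm_num)
    have hz : HasDerivAt (fun x => ∫ t in (-1 : ℝ)..x, g t) 0 x := by
      refine (hasDerivAt_const x (0 : E 𝕜 n)).congr_of_eventuallyEq ?_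
      filter_upwards [Icc_mem_nhds (lt_of_le_of_ne hxI.1 (Ne.symm hx1))
        (lt_of_le_of_ne hxI.2 hx0)] with y hy
      simpa [prim] using h1 hy
    exact hd.unique hz
  have : g = 0 := Lp.ext (hg.trans (Lp.coeFn_zero _ _ _).symm)
  rw [this]
  rfl

/-- The Sobolev space `H¹([-1, 0]; 𝕜ⁿ)`, as a subspace of `L₂(-1, 0; 𝕜ⁿ)`: the functions that agree
almost everywhere with an absolutely continuous function whose derivative is in `L₂`. -/
def H1 (𝕜 : Type*) [RCLike 𝕜] (n : ℕ) : Submodule 𝕜 (L2 𝕜 n) := LinearMap.range (primL2 𝕜 n)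

/-- A function `c + ∫_{-1}^θ g` of `H¹` is determined by its value `c` at `-1` and its weak
derivative `g`. -/
def H1.equiv (𝕜 : Type*) [RCLike 𝕜] (n : ℕ) : (E 𝕜 n × L2 𝕜 n) ≃ₗ[𝕜] H1 𝕜 n :=
  LinearEquiv.ofInjective (primL2 𝕜 n) primL2_injective

/-- The weak derivative `d/dθ : H¹ → L₂`. -/
def H1.deriv : H1 𝕜 n →ₗ[𝕜] L2 𝕜 n :=
  LinearMap.snd 𝕜 (E 𝕜 n) (L2 𝕜 n) ∘ₗ (H1.equiv 𝕜 n).symm.toLinearMap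

/-- The continuous representative of a function of `H¹`, on `[-1, 0]`. -/
def H1.rep (f : H1 𝕜 n) : ℝ → E 𝕜 n :=
  prim ((H1.equiv 𝕜 n).symm f).1 ((H1.equiv 𝕜 n).symm f).2

theorem H1.rep_add {θ : ℝ} (hθ : θ ∈ Icc (-1 : ℝ) 0) (f f' : H1 𝕜 n) :
    H1.rep (f + f') θ = H1.rep f θ + H1.rep f' θ := by
  simp only [H1.rep, map_add, Prod.fst_add, Prod.snd_add, prim_add hθ]

theorem H1.rep_smul {θ : ℝ} (hθ : θ ∈ Icc (-1 : ℝ) 0) (a : 𝕜) (f : H1 𝕜 n) :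
    H1.rep (a • f) θ = a • H1.rep f θ := by
  simp only [H1.rep, map_smul, Prod.smul_fst, Prod.smul_snd, prim_smul hθ]

theorem H1.rep_zero {θ : ℝ} (hθ : θ ∈ Icc (-1 : ℝ) 0) : H1.rep (0 : H1 𝕜 n) θ = 0 := by
  simpa using H1.rep_smul hθ (0 : 𝕜) (0 : H1 𝕜 n)

theorem H1.rep_ae_eq (f : H1 𝕜 n) : (f : L2 𝕜 n) =ᵐ[μ] H1.rep f := by
  have h := (memLp_prim ((H1.equiv 𝕜 n).symm f).1 ((H1.equiv 𝕜 n).symm f).2).coeFn_toLp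
  have h2 : ((H1.equiv 𝕜 n) ((H1.equiv 𝕜 n).symm f) : L2 𝕜 n) = f := by
    rw [LinearEquiv.apply_symm_apply]
  change ((H1.equiv 𝕜 n) ((H1.equiv 𝕜 n).symm f) : L2 𝕜 n) =ᵐ[μ] _ at h
  rwa [h2] at h

theorem H1.rep_eq (f : H1 𝕜 n) (θ : ℝ) :
    H1.rep f θ = H1.rep f (-1) + ∫ s in (-1 : ℝ)..θ, H1.deriv f s := by
  simp [H1.rep, H1.deriv, prim]

theorem mem_left : (-1 : ℝ) ∈ Icc (-1 : ℝ) 0 := by norm_num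

theorem mem_right : (0 : ℝ) ∈ Icc (-1 : ℝ) 0 := by norm_num

/-! ### The convolutions in the definition of `F` -/

theorem measurePreserving_reflect : MeasurePreserving (fun θ : ℝ => -θ - 1) μ μ := by
  have h : MeasurePreserving (fun θ : ℝ => -1 - θ) volume volume :=
    volume.measurePreserving_sub_left (-1)
  have h' := h.restrict_preimage (s := Icc (-1 : ℝ) 0) measurableSet_Icc
  have e : (fun θ : ℝ => -1 - θ) ⁻¹' Icc (-1 : ℝ) 0 = Icc (-1 : ℝ) 0 := by
    ext x; simp only [mem_preimage, mem_Icc]; constructor <;> rintro ⟨h1, h2⟩ <;> constructor <;> linarith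
  rw [e] at h'
  have e2 : (fun θ : ℝ => -θ - 1) = fun θ => -1 - θ := by funext θ; ring
  rwa [e2]

theorem measurePreserving_shift (θ : ℝ) :
    MeasurePreserving (fun τ : ℝ => τ - θ - 1) (volume.restrict (Icc θ (θ + 1))) μ := by
  have h : MeasurePreserving (fun τ : ℝ => τ - (θ + 1)) volume volume :=
    measurePreserving_sub_right volume (θ + 1)
  have h' := h.restrict_preimage (s := Icc (-1 : ℝ) 0) measurableSet_Icc
  have e : (fun τ : ℝ => τ - (θ + 1)) ⁻¹' Icc (-1 : ℝ) 0 = Icc θ (θ + 1) := by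
    ext x; simp only [mem_preimage, mem_Icc]; constructor <;> rintro ⟨h1, h2⟩ <;> constructor <;> linarith
  rw [e] at h'
  have e2 : (fun τ : ℝ => τ - θ - 1) = fun τ => τ - (θ + 1) := by funext τ; ring
  rwa [e2]

theorem memLp_shift {θ : ℝ} (hθ : θ ∈ Icc (-1 : ℝ) 0) (f : L2 𝕜 n) :
    MemLp (fun τ => f (τ - θ - 1)) 2 (volume.restrict (Icc θ 0)) :=
  ((Lp.memLp f).comp_measurePreserving (measurePreserving_shift θ)).mono_measure
    (Measure.restrict_mono (Icc_subset_Icc le_rfl (by linarith [hθ.1])) le_rfl)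

theorem integrable_conv {B : ℝ → Matrix (Fin n) (Fin n) 𝕜}
    (hB : ∀ i j, MemLp (fun θ => B θ i j) 2 μ) (f : L2 𝕜 n) {θ : ℝ} (hθ : θ ∈ Icc (-1 : ℝ) 0) :
    IntervalIntegrable (fun τ => act (B τ) (f (τ - θ - 1))) volume 0 θ := by
  have h1 : MemLp (fun τ => act (B τ)) 2 (volume.restrict (Icc θ 0)) :=
    (memLp_act hB).mono_measure (Measure.restrict_mono (Icc_subset_Icc hθ.1 le_rfl) le_rfl)
  have h2 := (ContinuousLinearMap.id 𝕜 (E 𝕜 n →L[𝕜] E 𝕜 n)).memLp_of_bilin 1 h1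
    (memLp_shift hθ f)
  have h3 : IntegrableOn (fun τ => act (B τ) (f (τ - θ - 1))) (Icc θ 0) volume :=
    memLp_one_iff_integrable.1 h2
  rw [← uIcc_of_ge hθ.2] at h3
  exact h3.intervalIntegrable

/-- The function `θ ↦ ∫_0^θ B(τ) f(τ - θ - 1) dτ` on `[-1, 0]`. -/
def conv (B : ℝ → Matrix (Fin n) (Fin n) 𝕜) (f : L2 𝕜 n) (θ : ℝ) : E 𝕜 n :=
  ∫ τ in (0 : ℝ)..θ, act (B τ) (f (τ - θ - 1))

theorem ae_shift {p : ℝ → Prop} (hp : ∀ᵐ s ∂μ, p s) {θ : ℝ} (hθ : θ ∈ Icc (-1 : ℝ) 0) :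
    ∀ᵐ τ ∂(volume.restrict (uIoc 0 θ)), p (τ - θ - 1) := by
  have h := (measurePreserving_shift θ).quasiMeasurePreserving.ae hp
  refine ae_restrict_of_ae_restrict_of_subset ?_ h
  rw [uIoc_of_ge hθ.2]
  exact Ioc_subset_Icc_self.trans (Icc_subset_Icc le_rfl (by linarith [hθ.1]))

theorem conv_add {B : ℝ → Matrix (Fin n) (Fin n) 𝕜}
    (hB : ∀ i j, MemLp (fun θ => B θ i j) 2 μ) (f g : L2 𝕜 n) {θ : ℝ} (hθ : θ ∈ Icc (-1 : ℝ) 0) :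
    conv B (f + g) θ = conv B f θ + conv B g θ := by
  rw [conv, conv, conv, ← intervalIntegral.integral_add (integrable_conv hB f hθ)
    (integrable_conv hB g hθ)]
  refine intervalIntegral.integral_congr_ae_restrict ?_
  filter_upwards [ae_shift (Lp.coeFn_add f g) hθ] with τ hτ
  rw [hτ, Pi.add_apply, map_add]

theorem conv_smul (B : ℝ → Matrix (Fin n) (Fin n) 𝕜) (a : 𝕜) (f : L2 𝕜 n) {θ : ℝ}
    (hθ : θ ∈ Icc (-1 : ℝ) 0) : conv B (a • f) θ = a • conv B f θ := by
  rw [conv, conv, ← intervalIntegral.integral_smul]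
  refine intervalIntegral.integral_congr_ae_restrict ?_
  filter_upwards [ae_shift (Lp.coeFn_smul a f) hθ] with τ hτ
  rw [hτ, Pi.smul_apply, map_smul]

theorem norm_conv_le {B : ℝ → Matrix (Fin n) (Fin n) 𝕜}
    (hB : ∀ i j, MemLp (fun θ => B θ i j) 2 μ) (f : L2 𝕜 n) {θ : ℝ} (hθ : θ ∈ Icc (-1 : ℝ) 0) :
    ‖conv B f θ‖ ≤ (∫ τ, ‖act (B τ)‖ ^ 2 ∂μ) + ∫ s, ‖f s‖ ^ 2 ∂μ := by
  have hB2 : Integrable (fun τ => ‖act (B τ)‖ ^ 2) μ :=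
    (memLp_two_iff_integrable_sq_norm (memLp_act hB).1).1 (memLp_act hB)
  have hf2 : Integrable (fun s => ‖f s‖ ^ 2) μ :=
    (memLp_two_iff_integrable_sq_norm (Lp.memLp f).1).1 (Lp.memLp f)
  have hsub : Ioc θ 0 ⊆ Icc (-1 : ℝ) 0 :=
    Ioc_subset_Icc_self.trans (Icc_subset_Icc hθ.1 le_rfl)
  have hsub' : Ioc θ 0 ⊆ Icc θ (θ + 1) :=
    Ioc_subset_Icc_self.trans (Icc_subset_Icc le_rfl (by linarith [hθ.1]))
  have hs2 : Integrable (fun τ => ‖f (τ - θ - 1)‖ ^ 2) (volume.restrict (Icc θ (θ + 1))) :=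
    (measurePreserving_shift θ).integrable_comp_of_integrable hf2
  have e : ∫ τ in Icc θ (θ + 1), ‖f (τ - θ - 1)‖ ^ 2 = ∫ s, ‖f s‖ ^ 2 ∂μ := by
    have hme : MeasurableEmbedding (fun τ : ℝ => τ - θ - 1) := by
      have := (MeasurableEquiv.addRight (-θ - 1)).measurableEmbedding
      convert! this using 2
      simp; ring
    exact (measurePreserving_shift θ).integral_comp hme (fun s => ‖f s‖ ^ 2)
  have h1 : IntegrableOn (fun τ => ‖act (B τ)‖ ^ 2) (Ioc θ 0) volume :=
    IntegrableOn.mono_set (t := Icc (-1 : ℝ) 0) hB2 hsub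
  have h2 : IntegrableOn (fun τ => ‖f (τ - θ - 1)‖ ^ 2) (Ioc θ 0) volume :=
    IntegrableOn.mono_set (t := Icc θ (θ + 1)) hs2 hsub'
  calc ‖conv B f θ‖ ≤ ∫ τ in Ioc θ 0, ‖act (B τ) (f (τ - θ - 1))‖ := by
        rw [conv, ← uIoc_of_ge hθ.2]
        exact intervalIntegral.norm_integral_le_integral_norm_uIoc
    _ ≤ ∫ τ in Ioc θ 0, (‖act (B τ)‖ ^ 2 + ‖f (τ - θ - 1)‖ ^ 2) := by
        refine integral_mono_of_nonneg (.of_forall fun _ => norm_nonneg _) (h1.add h2)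
          (.of_forall fun τ => ?_)
        have := (act (B τ)).le_opNorm (f (τ - θ - 1))
        dsimp only
        nlinarith [sq_nonneg (‖act (B τ)‖ - ‖f (τ - θ - 1)‖), norm_nonneg (act (B τ)),
          norm_nonneg (f (τ - θ - 1)), sq_nonneg ‖act (B τ)‖, sq_nonneg ‖f (τ - θ - 1)‖]
    _ = (∫ τ in Ioc θ 0, ‖act (B τ)‖ ^ 2) + ∫ τ in Ioc θ 0, ‖f (τ - θ - 1)‖ ^ 2 :=
        integral_add h1 h2
    _ ≤ _ := by
        rw [← e]
        exact add_le_add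
          (setIntegral_mono_set hB2 (.of_forall fun _ => sq_nonneg _) hsub.eventuallyLE)
          (setIntegral_mono_set hs2 (.of_forall fun _ => sq_nonneg _) hsub'.eventuallyLE)

theorem memLp_conv {B : ℝ → Matrix (Fin n) (Fin n) 𝕜}
    (hB : ∀ i j, MemLp (fun θ => B θ i j) 2 μ) (f : L2 𝕜 n) : MemLp (conv B f) 2 μ := by
  have hm : AEStronglyMeasurable (conv B f) μ := by
    have hf : StronglyMeasurable (f : ℝ → E 𝕜 n) := Lp.stronglyMeasurable f
    have h1 : AEStronglyMeasurable
        (fun p : ℝ × ℝ => act (B p.2) (f (p.2 - p.1 - 1))) (μ.prod μ) := by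
      have a1 : AEStronglyMeasurable (fun p : ℝ × ℝ => act (B p.2)) (μ.prod μ) :=
        (memLp_act hB).1.comp_snd
      have a2 : AEStronglyMeasurable (fun p : ℝ × ℝ => f (p.2 - p.1 - 1)) (μ.prod μ) :=
        (hf.comp_measurable (by fun_prop)).aestronglyMeasurable
      exact (ContinuousLinearMap.id 𝕜 (E 𝕜 n →L[𝕜] E 𝕜 n)).aestronglyMeasurable_comp₂ a1 a2
    have hset : MeasurableSet {p : ℝ × ℝ | p.1 < p.2} := measurableSet_lt measurable_fst measurable_snd
    have h2 := (h1.indicator hset).integral_prod_right'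
    refine h2.neg.congr ?_
    refine (ae_restrict_iff' measurableSet_Icc).2 (.of_forall fun θ hθ => ?_)
    rw [Pi.neg_apply, conv, intervalIntegral.integral_of_ge hθ.2]
    congr 1
    have e : (fun τ => ({p : ℝ × ℝ | p.1 < p.2}.indicator
        (fun p : ℝ × ℝ => act (B p.2) (f (p.2 - p.1 - 1)))) (θ, τ)) =
        (Ioi θ).indicator fun τ => act (B τ) (f (τ - θ - 1)) := by
      funext τ
      by_cases h : θ < τ <;> simp [indicator, h]
    rw [e, integral_indicator measurableSet_Ioi, Measure.restrict_restrict measurableSet_Ioi]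
    congr 2
    ext τ
    simp only [mem_inter_iff, mem_Ioi, mem_Icc, mem_Ioc]
    constructor
    · rintro ⟨h, -, h'⟩; exact ⟨h, h'⟩
    · rintro ⟨h, h'⟩; exact ⟨h, by linarith [hθ.1], h'⟩
  exact MemLp.of_bound hm _ ((ae_restrict_iff' measurableSet_Icc).2
    (.of_forall fun θ hθ => norm_conv_le hB f hθ))

namespace Coeffs

variable (S : Coeffs 𝕜 n)

/-! ### The operator `Ã` -/

/-- The domain `D(Ã)`: the pairs `(w, ψ)` such that `r = ψ + A₂(·) w` is in `H¹` and
`r(-1) = A₋₁ r(0)`. The latter is the condition `(A₋₁ A₂(0) - A₂(-1)) w = ψ(-1) - A₋₁ ψ(0)`, where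
`ψ(θ) + A₂(θ) w` stands for the value `r(θ)` of the continuous representative. -/
def domTilde : Submodule 𝕜 (M2 𝕜 n) where
  carrier := {x | ∃ r : H1 𝕜 n, (r : L2 𝕜 n) = x.snd + mulVecL2 S.A2 S.memLp_A2 x.fst ∧
    H1.rep r (-1) = act S.Am1 (H1.rep r 0)}
  add_mem' := by
    rintro x y ⟨r, hr, hr'⟩ ⟨s, hs, hs'⟩
    refine ⟨r + s, ?_, ?_⟩
    · rw [Submodule.coe_add, hr, hs, WithLp.add_fst, WithLp.add_snd, map_add]
      abel
    · rw [H1.rep_add mem_left, H1.rep_add mem_right, hr', hs', map_add]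
  zero_mem' := ⟨0, by simp, by rw [H1.rep_zero mem_left, H1.rep_zero mem_right, map_zero]⟩
  smul_mem' := by
    rintro a x ⟨r, hr, hr'⟩
    refine ⟨a • r, ?_, ?_⟩
    · rw [Submodule.coe_smul, hr, WithLp.smul_fst, WithLp.smul_snd, map_smul, smul_add]
    · rw [H1.rep_smul mem_left, H1.rep_smul mem_right, hr', map_smul]

/-- For `x = (w, ψ) ∈ D(Ã)`, the function `r = ψ + A₂(·) w ∈ H¹`. -/
def rFun (x : S.domTilde) : H1 𝕜 n :=
  ⟨x.1.snd + mulVecL2 S.A2 S.memLp_A2 x.1.fst, by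
    obtain ⟨r, hr, -⟩ := x.2
    rw [← hr]
    exact r.2⟩

theorem rFun_add (x y : S.domTilde) : S.rFun (x + y) = S.rFun x + S.rFun y := by
  refine Subtype.ext ?_
  simp only [rFun, Submodule.coe_add, WithLp.add_fst, WithLp.add_snd, map_add]
  abel

theorem rFun_smul (a : 𝕜) (x : S.domTilde) : S.rFun (a • x) = a • S.rFun x := by
  refine Subtype.ext ?_
  simp only [rFun, Submodule.coe_smul, WithLp.smul_fst, WithLp.smul_snd, map_smul, smul_add]

/-- The operator `Ã (w, ψ) = (A₂(0) w + ψ(0), -d/dθ [ψ(θ) + A₂(θ) w] + A₃(θ) w)` in `M₂`, with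
domain `D(Ã)`. -/
def Atilde : M2 𝕜 n →ₗ.[𝕜] M2 𝕜 n where
  domain := S.domTilde
  toFun :=
    { toFun := fun x => WithLp.toLp 2
        (H1.rep (S.rFun x) 0, -H1.deriv (S.rFun x) + mulVecL2 S.A3 S.memLp_A3 x.1.fst)
      map_add' := fun x y => by
        rw [← WithLp.toLp_add, rFun_add, H1.rep_add mem_right, map_add, Submodule.coe_add,
          WithLp.add_fst, map_add, Prod.mk_add_mk]
        congr 2
        abel
      map_smul' := fun a x => by
        rw [RingHom.id_apply, ← WithLp.toLp_smul, rFun_smul, H1.rep_smul mem_right, map_smul,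
          Submodule.coe_smul, WithLp.smul_fst, map_smul, Prod.smul_mk, smul_add, smul_neg] }

/-! ### The operator `F` -/

/-- The domain `D(𝒜)`: the pairs `(v, z)` such that `z ∈ H¹` and `v = z(0) - A₋₁ z(-1)`. -/
def domA : Submodule 𝕜 (M2 𝕜 n) where
  carrier := {x | ∃ z : H1 𝕜 n, (z : L2 𝕜 n) = x.snd ∧
    x.fst = H1.rep z 0 - act S.Am1 (H1.rep z (-1))}
  add_mem' := by
    rintro x y ⟨r, hr, hr'⟩ ⟨s, hs, hs'⟩
    refine ⟨r + s, ?_, ?_⟩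
    · rw [Submodule.coe_add, hr, hs, WithLp.add_snd]
    · rw [WithLp.add_fst, H1.rep_add mem_left, H1.rep_add mem_right, hr', hs', map_add]
      abel
  zero_mem' := ⟨0, by simp, by rw [H1.rep_zero mem_left, H1.rep_zero mem_right]; simp⟩
  smul_mem' := by
    rintro a x ⟨r, hr, hr'⟩
    refine ⟨a • r, ?_, ?_⟩
    · rw [Submodule.coe_smul, hr, WithLp.smul_snd]
    · rw [WithLp.smul_fst, H1.rep_smul mem_left, H1.rep_smul mem_right, hr', map_smul, smul_sub]

/-- For `x = (v, z) ∈ D(𝒜)`, the function `z ∈ H¹`. -/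
def zFun (x : S.domA) : H1 𝕜 n :=
  ⟨x.1.snd, by
    obtain ⟨z, hz, -⟩ := x.2
    rw [← hz]
    exact z.2⟩

theorem zFun_add (x y : S.domA) : S.zFun (x + y) = S.zFun x + S.zFun y := rfl

theorem zFun_smul (a : 𝕜) (x : S.domA) : S.zFun (a • x) = a • S.zFun x := rfl

/-- For `z ∈ H¹`, the function
`ψ(θ) = z'(-θ-1) + ∫_0^θ A₂(τ) z'(τ-θ-1) dτ + ∫_0^θ A₃(τ) z(τ-θ-1) dτ - A₂(θ) z(-1)` on `[-1, 0]`.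
In terms of `w(s) = z(s-1)`, `0 ≤ s ≤ 1`, this is
`ψ(θ) + A₂(θ) w(0) = w'(-θ) + ∫_0^θ [A₂(τ) w'(τ-θ) + A₃(τ) w(τ-θ)] dτ`. -/
def psiFun (z : H1 𝕜 n) (θ : ℝ) : E 𝕜 n :=
  H1.deriv z (-θ - 1) + conv S.A2 (H1.deriv z) θ + conv S.A3 z θ
    - act (S.A2 θ) (H1.rep z (-1))

theorem memLp_psiFun (z : H1 𝕜 n) : MemLp (S.psiFun z) 2 μ :=
  ((((Lp.memLp (H1.deriv z)).comp_measurePreserving measurePreserving_reflect).add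
    (memLp_conv S.memLp_A2 _)).add (memLp_conv S.memLp_A3 _)).sub (memLp_act_const S.memLp_A2 _)

theorem psiFun_add (y z : H1 𝕜 n) : S.psiFun (y + z) =ᵐ[μ] S.psiFun y + S.psiFun z := by
  filter_upwards [measurePreserving_reflect.quasiMeasurePreserving.ae
    (Lp.coeFn_add (H1.deriv y) (H1.deriv z)), ae_restrict_mem measurableSet_Icc] with θ h hθ
  simp only [psiFun, Pi.add_apply, map_add, Submodule.coe_add, conv_add S.memLp_A2 _ _ hθ,
    conv_add S.memLp_A3 _ _ hθ, H1.rep_add mem_left] at h ⊢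
  rw [h]
  abel

theorem psiFun_smul (a : 𝕜) (z : H1 𝕜 n) : S.psiFun (a • z) =ᵐ[μ] a • S.psiFun z := by
  filter_upwards [measurePreserving_reflect.quasiMeasurePreserving.ae
    (Lp.coeFn_smul a (H1.deriv z)), ae_restrict_mem measurableSet_Icc] with θ h hθ
  have h1 : H1.deriv (a • z) (-θ - 1) = a • H1.deriv z (-θ - 1) := by
    rw [map_smul]
    exact h
  have h2 : conv S.A2 (H1.deriv (a • z)) θ = a • conv S.A2 (H1.deriv z) θ := by
    rw [map_smul]
    exact conv_smul _ _ _ hθ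
  have h3 : conv S.A3 (a • z : H1 𝕜 n) θ = a • conv S.A3 z θ := conv_smul _ _ _ hθ
  have h4 : act (S.A2 θ) (H1.rep (a • z) (-1)) = a • act (S.A2 θ) (H1.rep z (-1)) := by
    rw [H1.rep_smul mem_left, map_smul]
  rw [Pi.smul_apply, psiFun, psiFun, h1, h2, h3, h4, smul_sub, smul_add, smul_add]

/-- The class of `psiFun z` in `L₂(-1, 0; 𝕜ⁿ)`. -/
def psi : H1 𝕜 n →ₗ[𝕜] L2 𝕜 n where
  toFun z := (S.memLp_psiFun z).toLp (S.psiFun z)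
  map_add' y z := by
    rw [← MemLp.toLp_add]
    exact MemLp.toLp_congr _ _ (S.psiFun_add y z)
  map_smul' a z := by
    rw [RingHom.id_apply, ← MemLp.toLp_const_smul]
    exact MemLp.toLp_congr _ _ (S.psiFun_smul a z)

/-- The operator `F (v, z) = (w(0), ψ)`, with domain `D(𝒜)`, where `w(s) = z(s-1)` for `0 ≤ s ≤ 1`
and `ψ` is given by `psiFun`. -/
def F : M2 𝕜 n →ₗ.[𝕜] M2 𝕜 n where
  domain := S.domA
  toFun :=
    { toFun := fun x => WithLp.toLp 2 (H1.rep (S.zFun x) (-1), S.psi (S.zFun x))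
      map_add' := fun x y => by
        rw [← WithLp.toLp_add, zFun_add, H1.rep_add mem_left, map_add, Prod.mk_add_mk]
      map_smul' := fun a x => by
        rw [RingHom.id_apply, ← WithLp.toLp_smul, zFun_smul, H1.rep_smul mem_left, map_smul,
          Prod.smul_mk] }

end Coeffs

/-! ### Spectrum of an unbounded operator -/

/-- The resolvent set of a (possibly unbounded) operator `A` in `X` with domain `D(A)`: the `λ` for
which `λ I - A : D(A) → X` is bijective with bounded inverse. -/
def resolventSet {X : Type*} [NormedAddCommGroup X] [NormedSpace 𝕜 X] (A : X →ₗ.[𝕜] X) : Set 𝕜 :=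
  {l | ∃ R : X →L[𝕜] X, (∀ x : A.domain, R (l • (x : X) - A x) = x) ∧
    ∀ y : X, ∃ x : A.domain, (x : X) = R y ∧ l • (x : X) - A x = y}

/-- The spectrum `σ(A)` of a (possibly unbounded) operator. -/
def spectrum {X : Type*} [NormedAddCommGroup X] [NormedSpace 𝕜 X] (A : X →ₗ.[𝕜] X) : Set 𝕜 :=
  (resolventSet A)ᶜ

end NeutralSystem

end

noncomputable section

namespace NeutralSystem

variable {𝕜 : Type*} [RCLike 𝕜] {n : ℕ}

/-! ### Volterra operators on `L₂(-1, 0; 𝕜ⁿ)` -/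

/-! Write `R` for the reflection `f ↦ f(-θ-1)`, `V` for integration from `0`, and `B *` for `conv
B`. The operators `V` and `(B *) R` are Volterra: their value at `θ` is controlled by the `L₂` mass
of the argument on `[θ, 0]`. Iterating this bound makes some power of such an operator a
contraction, so `1 + W` is bijective for every Volterra `W` (`IsVolterra.bijective_one_add`).

Bijectivity of `F`: since `z = z(-1) - R V R z'`, the component `ψ` equals `(1 + W) R z'` plus a
term in `z(-1)`, with `W` Volterra (`psi_eq_derivOp`). So `F (v, z)` determines, and can prescribe,
the pair `(z(-1), z')`, which parametrizes `H¹`.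

Extension: the equation `F (v, z) = (λ I - Ã)(w, ψ)` contains `z'` and `r'`. Integrating it from `0`
to `θ` removes both, because `V (B * z') = V (B z(-1)) - B * z` (`volt_convL_deriv`). What remains
is `Q z = G w - U ψ` in `L₂`, with `Q = (1 + W') R` and `U = 1 + λ V` bijective. Its value at `θ =
-1`, combined with `r(-1) = A₋₁ r(0)`, gives `v = D w + K ψ + L z`. All these operators are bounded,
so they define `T` on the whole of `M₂`.

Inverting `T` reduces, after eliminating `ψ` through `U⁻¹`, to the endomorphism `D + K U⁻¹ G` of
`𝕜ⁿ` (`exists_equiv_of_triangular`). A vector `w` in its kernel is the first component of a solution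
of `Ã x = λ x` (`exists_eigenvector`), so it vanishes because `λ` is not in the spectrum. -/

theorem sq_integral_mul_le {α : Type*} [MeasurableSpace α] {ν : Measure α} {a b : α → ℝ}
    (ha : MemLp a 2 ν) (hb : MemLp b 2 ν) (ha0 : ∀ x, 0 ≤ a x) (hb0 : ∀ x, 0 ≤ b x) :
    (∫ x, a x * b x ∂ν) ^ 2 ≤ (∫ x, a x ^ 2 ∂ν) * ∫ x, b x ^ 2 ∂ν := by
  have h := integral_mul_le_Lp_mul_Lq_of_nonneg (p := 2) (q := 2) (μ := ν)
    (by norm_num [Real.holderConjugate_iff]) (.of_forall ha0) (.of_forall hb0)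
    (by simpa using ha) (by simpa using hb)
  simp only [Real.rpow_two, ← Real.sqrt_eq_rpow] at h
  have hA : 0 ≤ ∫ x, a x ^ 2 ∂ν := integral_nonneg fun _ => sq_nonneg _
  have hB : 0 ≤ ∫ x, b x ^ 2 ∂ν := integral_nonneg fun _ => sq_nonneg _
  calc (∫ x, a x * b x ∂ν) ^ 2
      ≤ (√(∫ x, a x ^ 2 ∂ν) * √(∫ x, b x ^ 2 ∂ν)) ^ 2 :=
        pow_le_pow_left₀ (integral_nonneg fun x => mul_nonneg (ha0 x) (hb0 x)) h 2
    _ = _ := by rw [mul_pow, Real.sq_sqrt hA, Real.sq_sqrt hB]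

theorem integrable_sq (f : L2 𝕜 n) : Integrable (fun s => ‖f s‖ ^ 2) μ :=
  (memLp_two_iff_integrable_sq_norm (Lp.memLp f).1).1 (Lp.memLp f)

/-- The energy `∫_θ^0 ‖f(s)‖² ds` of `f` on `[θ, 0]`. -/
def energy (f : L2 𝕜 n) (θ : ℝ) : ℝ := ∫ s in θ..0, ‖f s‖ ^ 2

theorem energy_eq (f : L2 𝕜 n) {θ : ℝ} (hθ : θ ∈ Icc (-1 : ℝ) 0) :
    energy f θ = ∫ s in Icc θ 0, ‖f s‖ ^ 2 := by
  rw [energy, intervalIntegral.integral_of_le hθ.2, integral_Icc_eq_integral_Ioc]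

theorem norm_sq_eq_integral (f : L2 𝕜 n) : ‖f‖ ^ 2 = ∫ s, ‖f s‖ ^ 2 ∂μ := by
  have h := inner_self_eq_norm_sq_to_K (𝕜 := 𝕜) f
  rw [L2.inner_def] at h
  simp only [inner_self_eq_norm_sq_to_K] at h
  have e : ∫ s, ((‖f s‖ : 𝕜)) ^ 2 ∂μ = ((∫ s, ‖f s‖ ^ 2 ∂μ : ℝ) : 𝕜) := by
    rw [← integral_ofReal]
    simp
  rw [e] at h
  exact_mod_cast h.symm

theorem energy_neg_one (f : L2 𝕜 n) : energy f (-1) = ‖f‖ ^ 2 := by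
  rw [energy_eq f mem_left, norm_sq_eq_integral]

theorem energy_nonneg (f : L2 𝕜 n) {θ : ℝ} (hθ : θ ∈ Icc (-1 : ℝ) 0) : 0 ≤ energy f θ :=
  intervalIntegral.integral_nonneg hθ.2 fun _ _ => sq_nonneg _

theorem energy_anti (f : L2 𝕜 n) {θ s : ℝ} (hθ : θ ∈ Icc (-1 : ℝ) 0) (hs : s ∈ Icc (-1 : ℝ) 0)
    (h : θ ≤ s) : energy f s ≤ energy f θ := by
  rw [energy_eq f hθ, energy_eq f hs]
  have hi : IntegrableOn (fun s => ‖f s‖ ^ 2) (Icc (-1 : ℝ) 0) volume := integrable_sq f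
  exact setIntegral_mono_set (hi.mono_set (Icc_subset_Icc hθ.1 le_rfl))
    (.of_forall fun _ => sq_nonneg _) (Icc_subset_Icc h le_rfl).eventuallyLE

theorem energy_le_norm_sq (f : L2 𝕜 n) {θ : ℝ} (hθ : θ ∈ Icc (-1 : ℝ) 0) :
    energy f θ ≤ ‖f‖ ^ 2 := by
  rw [← energy_neg_one]
  exact energy_anti f mem_left hθ hθ.1

theorem intervalIntegrable_energy (f : L2 𝕜 n) {θ : ℝ} (hθ : θ ∈ Icc (-1 : ℝ) 0) :
    IntervalIntegrable (energy f) volume θ 0 := by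
  refine AntitoneOn.intervalIntegrable fun s hs t ht hst => ?_
  have hsub : uIcc θ 0 ⊆ Icc (-1 : ℝ) 0 := uIcc_subset_Icc hθ mem_right
  exact energy_anti f (hsub hs) (hsub ht) hst

/-- A bounded operator `W` on `L₂` with `‖(W f)(θ)‖² ≤ C ∫_θ^0 ‖f(s)‖² ds`. -/
def IsVolterra (W : L2 𝕜 n →L[𝕜] L2 𝕜 n) : Prop :=
  ∃ C, 0 ≤ C ∧ ∀ f : L2 𝕜 n, ∀ᵐ θ ∂μ, ‖W f θ‖ ^ 2 ≤ C * energy f θ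

theorem energy_apply_le {W : L2 𝕜 n →L[𝕜] L2 𝕜 n} {C : ℝ}
    (h : ∀ f : L2 𝕜 n, ∀ᵐ θ ∂μ, ‖W f θ‖ ^ 2 ≤ C * energy f θ) (f : L2 𝕜 n) {θ : ℝ}
    (hθ : θ ∈ Icc (-1 : ℝ) 0) : energy (W f) θ ≤ C * ∫ s in θ..0, energy f s := by
  rw [← intervalIntegral.integral_const_mul, energy]
  have hi : IntegrableOn (fun s => ‖W f s‖ ^ 2) (Icc (-1 : ℝ) 0) volume := integrable_sq _
  refine intervalIntegral.integral_mono_ae_restrict hθ.2 ?_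
    ((intervalIntegrable_energy f hθ).const_mul C) ?_
  · exact (hi.mono_set (uIcc_subset_Icc hθ mem_right)).intervalIntegrable
  · exact ae_restrict_of_ae_restrict_of_subset (Icc_subset_Icc hθ.1 le_rfl) (h f)

theorem IsVolterra.add {W₁ W₂ : L2 𝕜 n →L[𝕜] L2 𝕜 n} (h₁ : IsVolterra W₁) (h₂ : IsVolterra W₂) :
    IsVolterra (W₁ + W₂) := by
  obtain ⟨C, hC, h₁⟩ := h₁
  obtain ⟨D, hD, h₂⟩ := h₂
  refine ⟨2 * (C + D), by positivity, fun f => ?_⟩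
  filter_upwards [h₁ f, h₂ f, Lp.coeFn_add (W₁ f) (W₂ f)] with θ a b e
  rw [add_apply, e, Pi.add_apply]
  have := pow_le_pow_left₀ (norm_nonneg _) (norm_add_le (W₁ f θ) (W₂ f θ)) 2
  nlinarith [sq_nonneg (‖W₁ f θ‖ - ‖W₂ f θ‖)]

theorem IsVolterra.smul {W : L2 𝕜 n →L[𝕜] L2 𝕜 n} (h : IsVolterra W) (c : 𝕜) :
    IsVolterra (c • W) := by
  obtain ⟨C, hC, h⟩ := h
  refine ⟨‖c‖ ^ 2 * C, by positivity, fun f => ?_⟩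
  filter_upwards [h f, Lp.coeFn_smul c (W f)] with θ a e
  rw [smul_apply, e, Pi.smul_apply, norm_smul, mul_pow, mul_assoc]
  exact mul_le_mul_of_nonneg_left a (sq_nonneg _)

theorem IsVolterra.neg {W : L2 𝕜 n →L[𝕜] L2 𝕜 n} (h : IsVolterra W) : IsVolterra (-W) := by
  simpa using h.smul (-1)

/-- The energy of `W₂ f` on `[θ, 0]` is at most `D` times the integral of a decreasing function over
an interval of length at most `1`, hence at most `D * energy f θ`. -/
theorem IsVolterra.comp {W₁ W₂ : L2 𝕜 n →L[𝕜] L2 𝕜 n} (h₁ : IsVolterra W₁) (h₂ : IsVolterra W₂) :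
    IsVolterra (W₁ ∘L W₂) := by
  obtain ⟨C, hC, h₁⟩ := h₁
  obtain ⟨D, hD, h₂⟩ := h₂
  refine ⟨C * D, by positivity, fun f => ?_⟩
  filter_upwards [h₁ (W₂ f), ae_restrict_mem measurableSet_Icc] with θ a hθ
  refine a.trans ?_
  rw [mul_assoc]
  refine mul_le_mul_of_nonneg_left ((energy_apply_le h₂ f hθ).trans
    (mul_le_mul_of_nonneg_left ?_ hD)) hC
  calc ∫ s in θ..0, energy f s ≤ ∫ _ in θ..0, energy f θ :=
        intervalIntegral.integral_mono_on hθ.2 (intervalIntegrable_energy f hθ)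
          intervalIntegrable_const fun s hs => energy_anti f hθ ⟨hθ.1.trans hs.1, hs.2⟩ hs.1
    _ = -θ * energy f θ := by simp
    _ ≤ 1 * energy f θ :=
        mul_le_mul_of_nonneg_right (by linarith [hθ.1]) (energy_nonneg f hθ)
    _ = energy f θ := one_mul _

/-- Each application of `W` costs a factor `C` and one integration over `[θ, 0]`; the repeated
integrations of powers of `-s` produce the factorial. -/
theorem energy_pow_le {W : L2 𝕜 n →L[𝕜] L2 𝕜 n} {C : ℝ} (hC : 0 ≤ C)
    (h : ∀ f : L2 𝕜 n, ∀ᵐ θ ∂μ, ‖W f θ‖ ^ 2 ≤ C * energy f θ) (f : L2 𝕜 n) (m : ℕ) :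
    ∀ θ ∈ Icc (-1 : ℝ) 0,
      energy ((W ^ m) f) θ ≤ C ^ m / m.factorial * ‖f‖ ^ 2 * (-θ) ^ m := by
  induction m with
  | zero => intro θ hθ; simpa using energy_le_norm_sq f hθ
  | succ m ih =>
    intro θ hθ
    rw [pow_succ', mul_apply_eq_comp]
    refine (energy_apply_le h _ hθ).trans ?_
    have h1 : ∫ s in θ..0, energy ((W ^ m) f) s
        ≤ ∫ s in θ..0, C ^ m / m.factorial * ‖f‖ ^ 2 * (-s) ^ m :=
      intervalIntegral.integral_mono_on hθ.2 (intervalIntegrable_energy _ hθ)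
        (Continuous.intervalIntegrable (by fun_prop) _ _)
        fun s hs => ih s ⟨hθ.1.trans hs.1, hs.2⟩
    refine (mul_le_mul_of_nonneg_left h1 hC).trans (le_of_eq ?_)
    rw [intervalIntegral.integral_const_mul,
      intervalIntegral.integral_comp_neg (fun s : ℝ => s ^ m), integral_pow]
    simp only [neg_zero, Nat.factorial_succ, Nat.cast_mul, Nat.cast_add, Nat.cast_one]
    rw [zero_pow (Nat.succ_ne_zero m)]
    have : (m.factorial : ℝ) ≠ 0 := by positivity
    have : (m : ℝ) + 1 ≠ 0 := by positivity
    field_simp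
    ring

/-- `W` itself need not be a contraction, but a high power of `-W` is. Then `1 - (-W) ^ m` is a
unit, and it factors as `1 + W` times a geometric sum. -/
theorem IsVolterra.bijective_one_add {W : L2 𝕜 n →L[𝕜] L2 𝕜 n} (h : IsVolterra W) :
    Function.Bijective ((1 : L2 𝕜 n →L[𝕜] L2 𝕜 n) + W) := by
  obtain ⟨C, hC, h'⟩ := h.neg
  have hm : ∃ m : ℕ, C ^ m / m.factorial < 1 :=
    ((FloorSemiring.tendsto_pow_div_factorial_atTop C).eventually
      (gt_mem_nhds one_pos)).exists
  obtain ⟨m, hm⟩ := hm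
  have hpos : 0 ≤ C ^ m / m.factorial := by positivity
  have hnorm : ‖(-W) ^ m‖ < 1 := by
    refine lt_of_le_of_lt (ContinuousLinearMap.opNorm_le_bound _ (Real.sqrt_nonneg _)
      fun f => ?_) ((Real.sqrt_lt' one_pos).2 (by simpa using hm))
    -- At `θ = -1` the energy is the full squared norm and `(-θ) ^ m = 1`.
    have := energy_pow_le hC h' f m (-1) mem_left
    rw [energy_neg_one, neg_neg, one_pow, mul_one] at this
    refine le_of_sq_le_sq ?_ (by positivity)
    rwa [mul_pow, Real.sq_sqrt hpos]
  have hu : IsUnit (1 - (-W) ^ m) := isUnit_one_sub_of_norm_lt_one hnorm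
  -- In a noncommutative ring a unit product has unit factors once the factors commute.
  have hc : Commute (1 - -W) (∑ i ∈ Finset.range m, (-W) ^ i) :=
    (mul_neg_geom_sum (-W) m).trans (geom_sum_mul_neg (-W) m).symm
  rw [← mul_neg_geom_sum, hc.isUnit_mul_iff, sub_neg_eq_add] at hu
  exact ContinuousLinearMap.isUnit_iff_bijective.1 hu.1

/-! ### Reflection, convolution and integration as bounded operators on `L₂` -/

/-- The reflection `f ↦ f(-θ - 1)`. -/
def reflect (𝕜 : Type*) [RCLike 𝕜] (n : ℕ) : L2 𝕜 n →L[𝕜] L2 𝕜 n :=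
  (Lp.compMeasurePreservingₗᵢ 𝕜 _ measurePreserving_reflect).toContinuousLinearMap

theorem reflect_ae (f : L2 𝕜 n) : reflect 𝕜 n f =ᵐ[μ] fun θ => f (-θ - 1) :=
  Lp.coeFn_compMeasurePreserving f measurePreserving_reflect

theorem reflect_reflect (f : L2 𝕜 n) : reflect 𝕜 n (reflect 𝕜 n f) = f := by
  refine Lp.ext ((reflect_ae _).trans ?_)
  filter_upwards [measurePreserving_reflect.quasiMeasurePreserving.ae (reflect_ae f)] with θ h
  rw [h]
  congr 1
  ring

theorem ae_restrict_uIoc {p : ℝ → Prop} (hp : ∀ᵐ s ∂μ, p s) {a b : ℝ} (ha : a ∈ Icc (-1 : ℝ) 0)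
    (hb : b ∈ Icc (-1 : ℝ) 0) : ∀ᵐ s ∂(volume.restrict (uIoc a b)), p s :=
  ae_restrict_of_ae_restrict_of_subset
    (uIoc_subset_uIcc.trans (uIcc_subset_Icc ha hb)) hp

/-- By changes of variable, both sides are the mass of `f` on `[-1, -θ-1]`. -/
theorem energy_reflect (f : L2 𝕜 n) {θ : ℝ} (hθ : θ ∈ Icc (-1 : ℝ) 0) :
    energy (reflect 𝕜 n f) θ = ∫ τ in θ..0, ‖f (τ - θ - 1)‖ ^ 2 := by
  have h1 : energy (reflect 𝕜 n f) θ = ∫ s in θ..0, ‖f (-s - 1)‖ ^ 2 := by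
    refine intervalIntegral.integral_congr_ae_restrict ?_
    filter_upwards [ae_restrict_uIoc (reflect_ae f) hθ mem_right] with s hs
    rw [hs]
  have h2 := intervalIntegral.integral_comp_sub_left (a := θ) (b := 0)
    (fun s => ‖f s‖ ^ 2) (-1 : ℝ)
  have h3 := intervalIntegral.integral_comp_sub_right (a := θ) (b := 0)
    (fun s => ‖f s‖ ^ 2) (θ + 1)
  rw [h1]
  calc _ = ∫ s in θ..0, ‖f (-1 - s)‖ ^ 2 := by
        congr 1; funext s; congr 3; ring
    _ = ∫ s in θ..0, ‖f (s - (θ + 1))‖ ^ 2 := by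
        rw [h2, h3]; congr 1 <;> ring
    _ = _ := by congr 1; funext s; congr 3; ring

/-- Cauchy–Schwarz. The convolution at `θ` sees `f` only on `[-1, -θ-1]`, the mirror image of `[θ,
0]`; this is why the reflection appears. -/
theorem norm_conv_sq_le {B : ℝ → Matrix (Fin n) (Fin n) 𝕜}
    (hB : ∀ i j, MemLp (fun θ => B θ i j) 2 μ) (f : L2 𝕜 n) {θ : ℝ} (hθ : θ ∈ Icc (-1 : ℝ) 0) :
    ‖conv B f θ‖ ^ 2 ≤ (∫ τ, ‖act (B τ)‖ ^ 2 ∂μ) * energy (reflect 𝕜 n f) θ := by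
  have hB2 : IntegrableOn (fun τ => ‖act (B τ)‖ ^ 2) (Icc (-1 : ℝ) 0) volume :=
    (memLp_two_iff_integrable_sq_norm (memLp_act hB).1).1 (memLp_act hB)
  have hsub : Ioc θ 0 ⊆ Icc (-1 : ℝ) 0 :=
    Ioc_subset_Icc_self.trans (Icc_subset_Icc hθ.1 le_rfl)
  have m1 : MemLp (fun τ => ‖act (B τ)‖) 2 (volume.restrict (Ioc θ 0)) :=
    ((memLp_act hB).mono_measure (Measure.restrict_mono hsub le_rfl)).norm
  have m2 : MemLp (fun τ => ‖f (τ - θ - 1)‖) 2 (volume.restrict (Ioc θ 0)) :=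
    ((memLp_shift hθ f).mono_measure (Measure.restrict_mono Ioc_subset_Icc_self le_rfl)).norm
  have h1 : ‖conv B f θ‖ ≤ ∫ τ in Ioc θ 0, ‖act (B τ)‖ * ‖f (τ - θ - 1)‖ := by
    rw [conv, intervalIntegral.integral_of_ge hθ.2, norm_neg]
    refine norm_integral_le_of_norm_le (m1.integrable_mul m2) (.of_forall fun τ => ?_)
    exact (act (B τ)).le_opNorm _
  refine (pow_le_pow_left₀ (norm_nonneg _) h1 2).trans ((sq_integral_mul_le m1 m2
    (fun _ => norm_nonneg _) fun _ => norm_nonneg _).trans ?_)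
  rw [energy_reflect f hθ, intervalIntegral.integral_of_le hθ.2]
  exact mul_le_mul_of_nonneg_right
    (setIntegral_mono_set hB2 (.of_forall fun _ => sq_nonneg _) hsub.eventuallyLE)
    (integral_nonneg fun _ => sq_nonneg _)

/-- The function `θ ↦ ∫_0^θ f(s) ds` on `[-1, 0]`. -/
def volt (f : L2 𝕜 n) (θ : ℝ) : E 𝕜 n := ∫ s in (0 : ℝ)..θ, f s

theorem volt_eq (f : L2 𝕜 n) {θ : ℝ} (hθ : θ ∈ Icc (-1 : ℝ) 0) :
    volt f θ = prim (-∫ s in (-1 : ℝ)..0, f s) f θ := by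
  rw [prim, volt, ← intervalIntegral.integral_add_adjacent_intervals
    (intervalIntegrable_L2 f mem_right mem_left) (intervalIntegrable_L2 f mem_left hθ),
    intervalIntegral.integral_symm]

theorem volt_congr {f : L2 𝕜 n} {g : ℝ → E 𝕜 n} (h : f =ᵐ[μ] g) {θ : ℝ}
    (hθ : θ ∈ Icc (-1 : ℝ) 0) : volt f θ = ∫ s in (0 : ℝ)..θ, g s :=
  intervalIntegral.integral_congr_ae_restrict (ae_restrict_uIoc h mem_right hθ)

theorem volt_add (f g : L2 𝕜 n) {θ : ℝ} (hθ : θ ∈ Icc (-1 : ℝ) 0) :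
    volt (f + g) θ = volt f θ + volt g θ := by
  rw [volt_congr (Lp.coeFn_add f g) hθ]
  exact intervalIntegral.integral_add (intervalIntegrable_L2 f mem_right hθ)
    (intervalIntegrable_L2 g mem_right hθ)

theorem volt_smul (a : 𝕜) (f : L2 𝕜 n) {θ : ℝ} (hθ : θ ∈ Icc (-1 : ℝ) 0) :
    volt (a • f) θ = a • volt f θ := by
  rw [volt_congr (Lp.coeFn_smul a f) hθ]
  exact intervalIntegral.integral_smul a f

theorem memLp_volt (f : L2 𝕜 n) : MemLp (volt f) 2 μ :=
  (memLp_congr_ae ((ae_restrict_iff' measurableSet_Icc).2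
    (.of_forall fun _ hθ => volt_eq f hθ))).2 (memLp_prim _ f)

theorem norm_volt_sq_le (f : L2 𝕜 n) {θ : ℝ} (hθ : θ ∈ Icc (-1 : ℝ) 0) :
    ‖volt f θ‖ ^ 2 ≤ energy f θ := by
  have hsub : Ioc θ 0 ⊆ Icc (-1 : ℝ) 0 :=
    Ioc_subset_Icc_self.trans (Icc_subset_Icc hθ.1 le_rfl)
  have m2 : MemLp (fun τ => ‖f τ‖) 2 (volume.restrict (Ioc θ 0)) :=
    ((Lp.memLp f).mono_measure (Measure.restrict_mono hsub le_rfl)).norm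
  have m1 : MemLp (fun _ => (1 : ℝ)) 2 (volume.restrict (Ioc θ 0)) := memLp_const 1
  have h1 : ‖volt f θ‖ ≤ ∫ τ in Ioc θ 0, 1 * ‖f τ‖ := by
    rw [volt, intervalIntegral.integral_of_ge hθ.2, norm_neg]
    simpa using norm_integral_le_integral_norm _
  refine (pow_le_pow_left₀ (norm_nonneg _) h1 2).trans ((sq_integral_mul_le m1 m2
    (fun _ => zero_le_one) fun _ => norm_nonneg _).trans ?_)
  rw [energy, intervalIntegral.integral_of_le hθ.2]
  refine mul_le_of_le_one_left (integral_nonneg fun _ => sq_nonneg _) ?_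
  simp only [one_pow, integral_const, smul_eq_mul, mul_one, measureReal_restrict_apply_univ,
    Real.volume_real_Ioc_of_le hθ.2]
  linarith [hθ.1]

/-- The interval `[-1, 0]` has measure `1`, so no constant is lost. -/
theorem norm_le_of_ae_le {f : L2 𝕜 n} {C : ℝ} (hC : 0 ≤ C) (h : ∀ᵐ θ ∂μ, ‖f θ‖ ≤ C) :
    ‖f‖ ≤ C := by
  have := Lp.norm_le_of_ae_bound hC h
  simpa [measureUnivNNReal] using this

theorem norm_conv_le_mul {B : ℝ → Matrix (Fin n) (Fin n) 𝕜}
    (hB : ∀ i j, MemLp (fun θ => B θ i j) 2 μ) (f : L2 𝕜 n) {θ : ℝ} (hθ : θ ∈ Icc (-1 : ℝ) 0) :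
    ‖conv B f θ‖ ≤ √(∫ τ, ‖act (B τ)‖ ^ 2 ∂μ) * ‖f‖ := by
  have h0 : 0 ≤ ∫ τ, ‖act (B τ)‖ ^ 2 ∂μ := integral_nonneg fun _ => sq_nonneg _
  refine le_of_sq_le_sq ?_ (by positivity)
  rw [mul_pow, Real.sq_sqrt h0]
  refine (norm_conv_sq_le hB f hθ).trans (mul_le_mul_of_nonneg_left ?_ h0)
  refine (energy_le_norm_sq _ hθ).trans (le_of_eq ?_)
  rw [reflect, LinearIsometry.coe_toContinuousLinearMap, LinearIsometry.norm_map]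

theorem norm_volt_le (f : L2 𝕜 n) {θ : ℝ} (hθ : θ ∈ Icc (-1 : ℝ) 0) :
    ‖volt f θ‖ ≤ 1 * ‖f‖ := by
  refine le_of_sq_le_sq ?_ (by positivity)
  rw [one_mul]
  exact (norm_volt_sq_le f hθ).trans (energy_le_norm_sq _ hθ)

/-- The value at `θ` of `conv B f`, as a bounded functional of `f`. -/
def convAt (B : ℝ → Matrix (Fin n) (Fin n) 𝕜) (hB : ∀ i j, MemLp (fun θ => B θ i j) 2 μ)
    {θ : ℝ} (hθ : θ ∈ Icc (-1 : ℝ) 0) : L2 𝕜 n →L[𝕜] E 𝕜 n :=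
  LinearMap.mkContinuous
    { toFun := fun f => conv B f θ
      map_add' := fun f g => conv_add hB f g hθ
      map_smul' := fun a f => conv_smul B a f hθ } √(∫ τ, ‖act (B τ)‖ ^ 2 ∂μ)
    fun f => norm_conv_le_mul hB f hθ

@[simp] theorem convAt_apply (B : ℝ → Matrix (Fin n) (Fin n) 𝕜)
    (hB : ∀ i j, MemLp (fun θ => B θ i j) 2 μ) {θ : ℝ} (hθ : θ ∈ Icc (-1 : ℝ) 0) (f : L2 𝕜 n) :
    convAt B hB hθ f = conv B f θ := rfl

/-- The value at `θ` of `volt f`, as a bounded functional of `f`. -/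
def voltAt {θ : ℝ} (hθ : θ ∈ Icc (-1 : ℝ) 0) : L2 𝕜 n →L[𝕜] E 𝕜 n :=
  LinearMap.mkContinuous
    { toFun := fun f => volt f θ
      map_add' := fun f g => volt_add f g hθ
      map_smul' := fun a f => volt_smul a f hθ } 1
    fun f => norm_volt_le f hθ

@[simp] theorem voltAt_apply {θ : ℝ} (hθ : θ ∈ Icc (-1 : ℝ) 0) (f : L2 𝕜 n) :
    voltAt hθ f = volt f θ := rfl

/-- The bounded operator `f ↦ conv B f` on `L₂`. -/
def convL (B : ℝ → Matrix (Fin n) (Fin n) 𝕜) (hB : ∀ i j, MemLp (fun θ => B θ i j) 2 μ) :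
    L2 𝕜 n →L[𝕜] L2 𝕜 n :=
  LinearMap.mkContinuous
    { toFun := fun f => (memLp_conv hB f).toLp (conv B f)
      map_add' := fun f g => by
        rw [← MemLp.toLp_add]
        exact MemLp.toLp_congr _ _ ((ae_restrict_iff' measurableSet_Icc).2
          (.of_forall fun θ hθ => conv_add hB f g hθ))
      map_smul' := fun a f => by
        rw [RingHom.id_apply, ← MemLp.toLp_const_smul]
        exact MemLp.toLp_congr _ _ ((ae_restrict_iff' measurableSet_Icc).2
          (.of_forall fun θ hθ => conv_smul B a f hθ)) } √(∫ τ, ‖act (B τ)‖ ^ 2 ∂μ) fun f => by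
    refine norm_le_of_ae_le (by positivity) ?_
    filter_upwards [(memLp_conv hB f).coeFn_toLp, ae_restrict_mem measurableSet_Icc] with θ h hθ
    exact h ▸ norm_conv_le_mul hB f hθ

theorem convL_ae (B : ℝ → Matrix (Fin n) (Fin n) 𝕜) (hB : ∀ i j, MemLp (fun θ => B θ i j) 2 μ)
    (f : L2 𝕜 n) : convL B hB f =ᵐ[μ] conv B f :=
  (memLp_conv hB f).coeFn_toLp

/-- The bounded operator `f ↦ volt f` on `L₂`. -/
def voltL (𝕜 : Type*) [RCLike 𝕜] (n : ℕ) : L2 𝕜 n →L[𝕜] L2 𝕜 n :=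
  LinearMap.mkContinuous
    { toFun := fun f => (memLp_volt f).toLp (volt f)
      map_add' := fun f g => by
        rw [← MemLp.toLp_add]
        exact MemLp.toLp_congr _ _ ((ae_restrict_iff' measurableSet_Icc).2
          (.of_forall fun θ hθ => volt_add f g hθ))
      map_smul' := fun a f => by
        rw [RingHom.id_apply, ← MemLp.toLp_const_smul]
        exact MemLp.toLp_congr _ _ ((ae_restrict_iff' measurableSet_Icc).2
          (.of_forall fun θ hθ => volt_smul a f hθ)) } 1 fun f => by
    refine norm_le_of_ae_le (by positivity) ?_
    filter_upwards [(memLp_volt f).coeFn_toLp, ae_restrict_mem measurableSet_Icc] with θ h hθ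
    exact h ▸ norm_volt_le f hθ

theorem voltL_ae (f : L2 𝕜 n) : voltL 𝕜 n f =ᵐ[μ] volt f :=
  (memLp_volt f).coeFn_toLp

theorem isVolterra_convL (B : ℝ → Matrix (Fin n) (Fin n) 𝕜)
    (hB : ∀ i j, MemLp (fun θ => B θ i j) 2 μ) : IsVolterra (convL B hB ∘L reflect 𝕜 n) := by
  refine ⟨∫ τ, ‖act (B τ)‖ ^ 2 ∂μ, integral_nonneg fun _ => sq_nonneg _, fun f => ?_⟩
  filter_upwards [convL_ae B hB (reflect 𝕜 n f), ae_restrict_mem measurableSet_Icc] with θ h hθ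
  rw [ContinuousLinearMap.comp_apply, h]
  have := norm_conv_sq_le hB (reflect 𝕜 n f) hθ
  rwa [reflect_reflect] at this

theorem isVolterra_voltL : IsVolterra (voltL 𝕜 n) := by
  refine ⟨1, zero_le_one, fun f => ?_⟩
  filter_upwards [voltL_ae f, ae_restrict_mem measurableSet_Icc] with θ h hθ
  rw [h, one_mul]
  exact norm_volt_sq_le f hθ

/-! ### Integration of the convolution -/

/-- Supplies the hypothesis of Fubini's theorem in `volt_convL`. -/
theorem integrable_triangle {B : ℝ → Matrix (Fin n) (Fin n) 𝕜}
    (hB : ∀ i j, MemLp (fun θ => B θ i j) 2 μ) (g : L2 𝕜 n) {θ : ℝ} (hθ : θ ∈ Icc (-1 : ℝ) 0) :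
    Integrable ({p : ℝ × ℝ | p.1 < p.2}.indicator
        (fun p : ℝ × ℝ => act (B p.2) (g (p.2 - p.1 - 1))))
      ((volume.restrict (Ioc θ 0)).prod (volume.restrict (Ioc θ 0))) := by
  have hsub : Ioc θ 0 ⊆ Icc (-1 : ℝ) 0 :=
    Ioc_subset_Icc_self.trans (Icc_subset_Icc hθ.1 le_rfl)
  have ha : Integrable (fun τ => act (B τ)) (volume.restrict (Ioc θ 0)) :=
    ((memLp_act hB).integrable one_le_two).mono_measure (Measure.restrict_mono hsub le_rfl)
  have hg' : IntegrableOn g (Icc (-1 : ℝ) 0) volume := (Lp.memLp g).integrable one_le_two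
  have hg : Integrable ((Icc (-1 : ℝ) 0).indicator g) volume :=
    hg'.integrable_indicator measurableSet_Icc
  have hk : Integrable (fun x => (Icc (-1 : ℝ) 0).indicator g (-1 - x)) volume :=
    hg.comp_sub_left (-1)
  have hset : MeasurableSet {p : ℝ × ℝ | p.1 < p.2} :=
    measurableSet_lt measurable_fst measurable_snd
  -- With `g` extended by zero, `g(τ-s-1)` is `x ↦ g(-1-x)` at `x = s-τ`, so the integrand is that
  -- of a convolution of two `L₁` functions.
  have h1 := ha.convolution_integrand (ContinuousLinearMap.id 𝕜 (E 𝕜 n →L[𝕜] E 𝕜 n)) hk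
  have h2 := (h1.mono_measure (Measure.prod_mono
    (Measure.restrict_le_self (s := Ioc θ 0)) le_rfl)).indicator hset
  refine h2.congr ?_
  rw [Measure.prod_restrict]
  filter_upwards [ae_restrict_mem (measurableSet_Ioc.prod measurableSet_Ioc)] with p hp
  by_cases hlt : p.1 < p.2
  · have e2 : -1 - (p.1 - p.2) ∈ Icc (-1 : ℝ) 0 :=
      ⟨by linarith, by linarith [hθ.1, hp.1.1, hp.2.2]⟩
    have e3 : p.2 - p.1 - 1 = -1 - (p.1 - p.2) := by ring
    have hm : p ∈ {p : ℝ × ℝ | p.1 < p.2} := hlt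
    rw [indicator_of_mem hm, indicator_of_mem hm, indicator_of_mem e2, ← e3]
    rfl
  · rw [indicator_of_notMem (by exact hlt), indicator_of_notMem (by exact hlt)]

theorem volt_reflect (g : L2 𝕜 n) {θ : ℝ} (hθ : θ ∈ Icc (-1 : ℝ) 0) :
    volt (reflect 𝕜 n g) θ = -∫ s in (-1 : ℝ)..(-θ - 1), g s := by
  have h1 := intervalIntegral.integral_comp_sub_left (a := 0) (b := θ) (fun s => g s) (-1 : ℝ)
  rw [volt_congr (reflect_ae g) hθ, ← intervalIntegral.integral_symm]
  calc _ = ∫ s in (0 : ℝ)..θ, g (-1 - s) := by congr 1; funext s; congr 1; ring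
    _ = _ := by rw [h1]; congr 1 <;> ring

theorem ae_shift_mem {θ : ℝ} (hθ : θ ∈ Icc (-1 : ℝ) 0) :
    ∀ τ ∈ Ioc θ 0, τ - θ - 1 ∈ Icc (-1 : ℝ) 0 :=
  fun τ hτ => ⟨by linarith [hτ.1], by linarith [hτ.2, hθ.1]⟩

/-- Fubini on the triangle `θ < s < τ ≤ 0`: integrating a convolution integrates its second factor.
Here `R V R g` is `x ↦ -∫_{-1}^x g`. -/
theorem volt_convL {B : ℝ → Matrix (Fin n) (Fin n) 𝕜}
    (hB : ∀ i j, MemLp (fun θ => B θ i j) 2 μ) (g : L2 𝕜 n) {θ : ℝ} (hθ : θ ∈ Icc (-1 : ℝ) 0) :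
    volt (convL B hB g) θ = conv B (reflect 𝕜 n (voltL 𝕜 n (reflect 𝕜 n g))) θ := by
  set k : ℝ × ℝ → E 𝕜 n := {p : ℝ × ℝ | p.1 < p.2}.indicator
    (fun p : ℝ × ℝ => act (B p.2) (g (p.2 - p.1 - 1))) with hk
  have hL : volt (convL B hB g) θ = ∫ s in Ioc θ 0, ∫ τ in Ioc θ 0, k (s, τ) := by
    rw [volt_congr (convL_ae B hB g) hθ, intervalIntegral.integral_of_ge hθ.2, ← integral_neg]
    refine setIntegral_congr_fun measurableSet_Ioc fun s hs => ?_
    have e : (fun τ => k (s, τ)) = (Ioi s).indicator fun τ => act (B τ) (g (τ - s - 1)) := by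
      funext τ
      by_cases h : s < τ <;> simp [hk, indicator, h]
    rw [conv, intervalIntegral.integral_of_ge hs.2, neg_neg, e,
      integral_indicator measurableSet_Ioi, Measure.restrict_restrict measurableSet_Ioi]
    congr 2
    ext τ
    simp only [mem_inter_iff, mem_Ioi, mem_Ioc]
    exact ⟨fun h => ⟨h.1, hs.1.trans h.1, h.2⟩, fun h => ⟨h.1, h.2.2⟩⟩
  have hR : conv B (reflect 𝕜 n (voltL 𝕜 n (reflect 𝕜 n g))) θ
      = ∫ τ in Ioc θ 0, ∫ s in Ioc θ 0, k (s, τ) := by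
    have hae : ∀ᵐ x ∂μ, reflect 𝕜 n (voltL 𝕜 n (reflect 𝕜 n g)) x
        = -∫ s in (-1 : ℝ)..x, g s := by
      filter_upwards [reflect_ae (voltL 𝕜 n (reflect 𝕜 n g)),
        measurePreserving_reflect.quasiMeasurePreserving.ae (voltL_ae (reflect 𝕜 n g)),
        ae_restrict_mem measurableSet_Icc] with x h1 h2 hx
      rw [h1, h2, volt_reflect g ⟨by linarith [hx.2], by linarith [hx.1]⟩]
      congr 2
      ring
    have hsh := ae_shift hae hθ
    rw [uIoc_of_ge hθ.2] at hsh
    rw [conv, intervalIntegral.integral_of_ge hθ.2, ← integral_neg]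
    refine integral_congr_ae ?_
    filter_upwards [hsh, ae_restrict_mem measurableSet_Ioc] with τ h1 hτ
    have hi : IntervalIntegrable g volume (-1) (τ - θ - 1) :=
      intervalIntegrable_L2 g mem_left (ae_shift_mem hθ τ hτ)
    have h2 := intervalIntegral.integral_comp_sub_left (a := θ) (b := τ) (fun s => g s) (τ - 1)
    have e : (fun s => k (s, τ)) = (Iio τ).indicator fun s => act (B τ) (g (τ - s - 1)) := by
      funext s
      by_cases h : s < τ <;> simp [hk, indicator, h]
    rw [h1, map_neg, neg_neg, e, integral_indicator measurableSet_Iio,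
      Measure.restrict_restrict measurableSet_Iio]
    have e2 : Iio τ ∩ Ioc θ 0 = Ioo θ τ := by
      ext s
      simp only [mem_inter_iff, mem_Iio, mem_Ioc, mem_Ioo]
      exact ⟨fun h => ⟨h.2.1, h.1⟩, fun h => ⟨h.2, h.1, h.2.le.trans hτ.2⟩⟩
    rw [e2, ← integral_Ioc_eq_integral_Ioo, ← intervalIntegral.integral_of_le hτ.1.le]
    have e3 : (fun s => act (B τ) (g (τ - s - 1))) = fun s => act (B τ) (g (τ - 1 - s)) := by
      funext s; congr 2; ring
    rw [e3, intervalIntegral.integral_comp_sub_left (fun s => act (B τ) (g s)) (τ - 1)]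
    have e4 : τ - 1 - τ = -1 := by ring
    have e5 : τ - 1 - θ = τ - θ - 1 := by ring
    rw [e4, e5]
    exact ((act (B τ)).intervalIntegral_comp_comm hi).symm
  rw [hL, hR]
  exact integral_integral_swap (integrable_triangle hB g hθ)

/-- The constant functions, as elements of `L₂`. -/
def constL2 (c : E 𝕜 n) : L2 𝕜 n := Lp.const 2 μ c

theorem constL2_ae (c : E 𝕜 n) : constL2 c =ᵐ[μ] fun _ => c := Lp.coeFn_const 2 μ c

theorem mulVecL2_ae (B : ℝ → Matrix (Fin n) (Fin n) 𝕜) (hB : ∀ i j, MemLp (fun θ => B θ i j) 2 μ)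
    (c : E 𝕜 n) : mulVecL2 B hB c =ᵐ[μ] fun θ => act (B θ) c :=
  (memLp_act_const hB c).coeFn_toLp

theorem conv_constL2 {B : ℝ → Matrix (Fin n) (Fin n) 𝕜}
    (hB : ∀ i j, MemLp (fun θ => B θ i j) 2 μ) (c : E 𝕜 n) {θ : ℝ} (hθ : θ ∈ Icc (-1 : ℝ) 0) :
    conv B (constL2 c) θ = volt (mulVecL2 B hB c) θ := by
  rw [volt_congr (mulVecL2_ae B hB c) hθ]
  refine intervalIntegral.integral_congr_ae_restrict ?_
  filter_upwards [ae_shift (constL2_ae c) hθ] with τ h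
  rw [h]

theorem volt_reflect_deriv (z : H1 𝕜 n) {θ : ℝ} (hθ : θ ∈ Icc (-1 : ℝ) 0) :
    volt (reflect 𝕜 n (H1.deriv z)) θ = H1.rep z (-1) - H1.rep z (-θ - 1) := by
  rw [volt_reflect _ hθ, H1.rep_eq z (-θ - 1)]
  abel

theorem volt_deriv (r : H1 𝕜 n) (θ : ℝ) (hθ : θ ∈ Icc (-1 : ℝ) 0) :
    volt (H1.deriv r) θ = H1.rep r θ - H1.rep r 0 := by
  rw [H1.rep_eq r θ, H1.rep_eq r 0, volt_eq _ hθ, prim]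
  abel

/-- The fundamental theorem of calculus from the endpoint `-1`, expressed through `R` and `V` so
that it composes with the other operators. -/
theorem coe_H1_eq (z : H1 𝕜 n) : (z : L2 𝕜 n) = constL2 (H1.rep z (-1))
    - reflect 𝕜 n (voltL 𝕜 n (reflect 𝕜 n (H1.deriv z))) := by
  refine Lp.ext ((H1.rep_ae_eq z).trans ?_)
  filter_upwards [Lp.coeFn_sub (constL2 (H1.rep z (-1)))
      (reflect 𝕜 n (voltL 𝕜 n (reflect 𝕜 n (H1.deriv z)))), constL2_ae (H1.rep z (-1)),
    reflect_ae (voltL 𝕜 n (reflect 𝕜 n (H1.deriv z))),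
    measurePreserving_reflect.quasiMeasurePreserving.ae (voltL_ae (reflect 𝕜 n (H1.deriv z))),
    ae_restrict_mem measurableSet_Icc] with x h1 h2 h3 h4 hx
  rw [h1, Pi.sub_apply, h2, h3, h4,
    volt_reflect_deriv z ⟨by linarith [hx.2], by linarith [hx.1]⟩, sub_sub_cancel]
  congr 1
  ring

/-- The integrated product rule `∫_0^θ (B * z') = ∫_0^θ B z(-1) - (B * z)(θ)`. -/
theorem volt_convL_deriv {B : ℝ → Matrix (Fin n) (Fin n) 𝕜}
    (hB : ∀ i j, MemLp (fun θ => B θ i j) 2 μ) (z : H1 𝕜 n) {θ : ℝ} (hθ : θ ∈ Icc (-1 : ℝ) 0) :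
    volt (convL B hB (H1.deriv z)) θ
      = volt (mulVecL2 B hB (H1.rep z (-1))) θ - conv B (z : L2 𝕜 n) θ := by
  have h := congrArg (convAt B hB hθ) (coe_H1_eq z)
  rw [map_sub] at h
  simp only [convAt_apply] at h
  rw [h, volt_convL hB _ hθ, conv_constL2 hB _ hθ, sub_sub_cancel]

/-! ### A triangular operator on `E × X` with `E` finite-dimensional -/

section Triangular

variable {Y X : Type*} [NormedAddCommGroup Y] [NormedSpace 𝕜 Y] [FiniteDimensional 𝕜 Y]
  [NormedAddCommGroup X] [NormedSpace 𝕜 X] [CompleteSpace X]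

/-- `T` sends `(w, p)` to `(D w + K p + L z, z)` with `z = Q⁻¹ (G w - U p)`. Solving for `p` leaves
the Schur complement `D + K U⁻¹ G` on `Y`. It is injective by `hker`, hence surjective because `Y`
is finite-dimensional. -/
theorem exists_equiv_of_triangular {Q U : X →L[𝕜] X} (hQ : Function.Bijective Q)
    (hU : Function.Bijective U) (G : Y →L[𝕜] X) (D : Y →L[𝕜] Y) (K L : X →L[𝕜] Y)
    (hker : ∀ w p, U p = G w → D w + K p = 0 → w = 0) :
    ∃ T : WithLp 2 (Y × X) ≃L[𝕜] WithLp 2 (Y × X), ∀ (x : WithLp 2 (Y × X)) (v : Y) (z : X),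
      Q z = G x.fst - U x.snd → v = D x.fst + K x.snd + L z → T x = WithLp.toLp 2 (v, z) := by
  have : CompleteSpace Y := FiniteDimensional.complete 𝕜 Y
  let Qe := ContinuousLinearEquiv.ofBijective Q (LinearMap.ker_eq_bot.2 hQ.1)
    (LinearMap.range_eq_top.2 hQ.2)
  let Ue := ContinuousLinearEquiv.ofBijective U (LinearMap.ker_eq_bot.2 hU.1)
    (LinearMap.range_eq_top.2 hU.2)
  have hQe : ∀ x, Q (Qe.symm x) = x := Qe.apply_symm_apply
  have hUe : ∀ x, U (Ue.symm x) = x := Ue.apply_symm_apply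
  have hQs : ∀ x, Qe.symm (Q x) = x := Qe.symm_apply_apply
  let Z : Y × X →L[𝕜] X := (Qe.symm : X →L[𝕜] X) ∘L
    (G ∘L ContinuousLinearMap.fst 𝕜 Y X - U ∘L ContinuousLinearMap.snd 𝕜 Y X)
  let T₀ : Y × X →L[𝕜] Y × X := ContinuousLinearMap.prod
    (D ∘L ContinuousLinearMap.fst 𝕜 Y X + K ∘L ContinuousLinearMap.snd 𝕜 Y X + L ∘L Z) Z
  have hZ : ∀ w p, Z (w, p) = Qe.symm (G w - U p) := fun _ _ => rfl
  have hT : ∀ w p, T₀ (w, p) = (D w + K p + L (Z (w, p)), Z (w, p)) := fun _ _ => rfl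
  let Δ : Y →ₗ[𝕜] Y := (D + K ∘L (Ue.symm : X →L[𝕜] X) ∘L G).toLinearMap
  have hΔ : ∀ w, Δ w = D w + K (Ue.symm (G w)) := fun _ => rfl
  have hΔi : Function.Injective Δ := by
    rw [injective_iff_map_eq_zero]
    exact fun w hw => hker w (Ue.symm (G w)) (hUe _) hw
  have hΔs : Function.Surjective Δ := LinearMap.injective_iff_surjective.1 hΔi
  have hi : Function.Injective T₀ := by
    rw [injective_iff_map_eq_zero]
    rintro ⟨w, p⟩ h
    rw [hT, Prod.mk_eq_zero] at h
    obtain ⟨h1, h2⟩ := h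
    have h3 : U p = G w := by
      have := hQe (G w - U p)
      rw [← hZ, h2, map_zero] at this
      exact (sub_eq_zero.1 this.symm).symm
    rw [h2, map_zero, add_zero] at h1
    have hw := hker w p h3 h1
    rw [hw, map_zero] at h3
    rw [hw, hU.1 (h3.trans (map_zero U).symm)]
    rfl
  have hs : Function.Surjective T₀ := by
    rintro ⟨v, z⟩
    -- Substitute `p = U⁻¹ (G w - Q z)`, forced by the second component, into the first.
    obtain ⟨w, hw⟩ := hΔs (v - L z + K (Ue.symm (Q z)))
    refine ⟨(w, Ue.symm (G w - Q z)), ?_⟩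
    have hz : Z (w, Ue.symm (G w - Q z)) = z := by
      rw [hZ, hUe, sub_sub_cancel, hQs]
    rw [hΔ] at hw
    rw [hT, hz, map_sub, map_sub, add_sub, hw]
    congr 1
    abel
  let e := WithLp.prodContinuousLinearEquiv 2 𝕜 Y X
  let Te := ContinuousLinearEquiv.ofBijective T₀ (LinearMap.ker_eq_bot.2 hi)
    (LinearMap.range_eq_top.2 hs)
  refine ⟨(e.trans Te).trans e.symm, fun x v z hz hv => ?_⟩
  have h1 : Z (x.fst, x.snd) = z := by rw [hZ, ← hz, hQs]
  have h2 : T₀ (x.fst, x.snd) = (v, z) := by rw [hT, h1, hv]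
  exact congrArg (WithLp.toLp 2) h2

end Triangular

namespace Coeffs

variable (S : Coeffs 𝕜 n)

/-! ### Bijectivity of `F` -/

theorem psi_eq (z : H1 𝕜 n) : S.psi z = reflect 𝕜 n (H1.deriv z)
    + convL S.A2 S.memLp_A2 (H1.deriv z) + convL S.A3 S.memLp_A3 (z : L2 𝕜 n)
    - mulVecL2 S.A2 S.memLp_A2 (H1.rep z (-1)) := by
  refine Lp.ext ((S.memLp_psiFun z).coeFn_toLp.trans ?_)
  filter_upwards [Lp.coeFn_sub (reflect 𝕜 n (H1.deriv z)
      + convL S.A2 S.memLp_A2 (H1.deriv z) + convL S.A3 S.memLp_A3 (z : L2 𝕜 n))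
      (mulVecL2 S.A2 S.memLp_A2 (H1.rep z (-1))),
    Lp.coeFn_add (reflect 𝕜 n (H1.deriv z) + convL S.A2 S.memLp_A2 (H1.deriv z))
      (convL S.A3 S.memLp_A3 (z : L2 𝕜 n)),
    Lp.coeFn_add (reflect 𝕜 n (H1.deriv z)) (convL S.A2 S.memLp_A2 (H1.deriv z)),
    reflect_ae (H1.deriv z), convL_ae S.A2 S.memLp_A2 (H1.deriv z),
    convL_ae S.A3 S.memLp_A3 (z : L2 𝕜 n), mulVecL2_ae S.A2 S.memLp_A2 (H1.rep z (-1))]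
    with θ h1 h2 h3 h4 h5 h6 h7
  rw [h1, Pi.sub_apply, h2, Pi.add_apply, h3, Pi.add_apply, h4, h5, h6, h7, psiFun]

/-- The principal part of `F`, acting on the derivative `z'`. -/
def derivOp : L2 𝕜 n →L[𝕜] L2 𝕜 n :=
  reflect 𝕜 n + convL S.A2 S.memLp_A2
    - convL S.A3 S.memLp_A3 ∘L reflect 𝕜 n ∘L voltL 𝕜 n ∘L reflect 𝕜 n

/-- The operator applied to `z` after integration of the equation `F (v, z) = (c, φ)`. -/
def intOp : L2 𝕜 n →L[𝕜] L2 𝕜 n :=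
  reflect 𝕜 n + convL S.A2 S.memLp_A2 - voltL 𝕜 n ∘L convL S.A3 S.memLp_A3

theorem reflect_bijective : Function.Bijective (reflect 𝕜 n) :=
  Function.Involutive.bijective reflect_reflect

/-- Since `R² = 1`, the reflection factors out on the right: `derivOp = (1 + W) R` with `W = (A₂ *)
R - (A₃ *) R V` Volterra. -/
theorem derivOp_bijective : Function.Bijective S.derivOp := by
  have hW := (isVolterra_convL S.A2 S.memLp_A2).add
    ((isVolterra_convL S.A3 S.memLp_A3).comp isVolterra_voltL).neg
  convert hW.bijective_one_add.comp reflect_bijective using 1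
  funext f
  simp [derivOp, reflect_reflect]
  abel

/-- The same factorization, with `W = (A₂ *) R - V (A₃ *) R`. -/
theorem intOp_bijective : Function.Bijective S.intOp := by
  have hW := (isVolterra_convL S.A2 S.memLp_A2).add
    (isVolterra_voltL.comp (isVolterra_convL S.A3 S.memLp_A3)).neg
  convert hW.bijective_one_add.comp reflect_bijective using 1
  funext f
  simp [intOp, reflect_reflect]
  abel

/-- Expresses `ψ` through the free coordinates `z(-1)` and `z'` of `H¹`, by inserting `coe_H1_eq`
into the `A₃` term. -/
theorem psi_eq_derivOp (z : H1 𝕜 n) : S.psi z = S.derivOp (H1.deriv z)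
    + (convL S.A3 S.memLp_A3 (constL2 (H1.rep z (-1)))
      - mulVecL2 S.A2 S.memLp_A2 (H1.rep z (-1))) := by
  rw [psi_eq]
  conv_lhs => rw [coe_H1_eq z]
  simp [derivOp]
  abel

theorem fst_eq (x : S.domA) :
    x.1.fst = H1.rep (S.zFun x) 0 - act S.Am1 (H1.rep (S.zFun x) (-1)) := by
  obtain ⟨z, hz, h⟩ := x.2
  have : S.zFun x = z := Subtype.ext hz.symm
  rw [this, h]

theorem equiv_symm_eq (z : H1 𝕜 n) :
    (H1.equiv 𝕜 n).symm z = (H1.rep z (-1), H1.deriv z) := by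
  refine Prod.ext ?_ rfl
  simp [H1.rep, prim]

theorem deriv_equiv (c : E 𝕜 n) (g : L2 𝕜 n) : H1.deriv (H1.equiv 𝕜 n (c, g)) = g := by
  simp [H1.deriv]

theorem rep_equiv (c : E 𝕜 n) (g : L2 𝕜 n) (θ : ℝ) :
    H1.rep (H1.equiv 𝕜 n (c, g)) θ = prim c g θ := by
  simp [H1.rep]

theorem F_injective : Function.Injective S.F := by
  have : Function.Injective S.F.toFun := by
    rw [injective_iff_map_eq_zero]
    intro x hx
    have hx' : WithLp.toLp 2 (H1.rep (S.zFun x) (-1), S.psi (S.zFun x)) = (0 : M2 𝕜 n) := hx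
    have h1 : H1.rep (S.zFun x) (-1) = 0 := congrArg WithLp.fst hx'
    have h2 : S.psi (S.zFun x) = 0 := congrArg WithLp.snd hx'
    have h0 : constL2 (0 : E 𝕜 n) = 0 := map_zero (Lp.const 2 μ)
    rw [psi_eq_derivOp, h1, map_zero, h0, map_zero, sub_zero, add_zero] at h2
    have h3 : H1.deriv (S.zFun x) = 0 :=
      S.derivOp_bijective.1 (h2.trans (map_zero S.derivOp).symm)
    have h4 : S.zFun x = 0 := by
      rw [← (H1.equiv 𝕜 n).symm.map_eq_zero_iff, equiv_symm_eq, h1, h3]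
      rfl
    have h5 := S.fst_eq x
    rw [h4, H1.rep_zero mem_left, H1.rep_zero mem_right, map_zero, sub_zero] at h5
    have h6 : x.1.snd = 0 := congrArg Subtype.val h4
    refine Subtype.ext (WithLp.ofLp_injective 2 (Prod.ext h5 h6))
  exact this

/-- The element `(z(0) - A₋₁ z(-1), z)` of `D(𝒜)`. -/
def ofH1 (z : H1 𝕜 n) : S.F.domain :=
  ⟨WithLp.toLp 2 (H1.rep z 0 - act S.Am1 (H1.rep z (-1)), (z : L2 𝕜 n)), z, rfl, rfl⟩

theorem F_ofH1 (z : H1 𝕜 n) :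
    S.F (S.ofH1 z) = WithLp.toLp 2 (H1.rep z (-1), S.psi z) := rfl

theorem F_surjective : Function.Surjective S.F := by
  intro y
  obtain ⟨g, hg⟩ := S.derivOp_bijective.2 (y.snd - (convL S.A3 S.memLp_A3 (constL2 y.fst)
      - mulVecL2 S.A2 S.memLp_A2 y.fst))
  have h1 : H1.rep (H1.equiv 𝕜 n (y.fst, g)) (-1) = y.fst := by simp [rep_equiv, prim]
  refine ⟨S.ofH1 (H1.equiv 𝕜 n (y.fst, g)), ?_⟩
  rw [F_ofH1, psi_eq_derivOp, deriv_equiv, h1, hg, sub_add_cancel]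
  rfl

/-! ### The equation `F (v, z) = (λ I - Ã) (w, ψ)` -/

/-- For `(v, z) ∈ D(𝒜)` and `(w, ψ) ∈ D(Ã)` with `F (v, z) = (λ I - Ã) (w, ψ)`, the equation for
`z` obtained by integration from `0` to `θ`. -/
theorem integrated_equation {l : 𝕜} {x : S.domTilde} {z : H1 𝕜 n}
    (h1 : H1.rep z (-1) = l • x.1.fst - H1.rep (S.rFun x) 0)
    (h2 : S.psi z = l • x.1.snd
      - (-H1.deriv (S.rFun x) + mulVecL2 S.A3 S.memLp_A3 x.1.fst))
    {θ : ℝ} (hθ : θ ∈ Icc (-1 : ℝ) 0) :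
    H1.rep z (-θ - 1) + conv S.A2 (z : L2 𝕜 n) θ - volt (convL S.A3 S.memLp_A3 (z : L2 𝕜 n)) θ
      = l • x.1.fst - H1.rep (S.rFun x) θ - l • volt x.1.snd θ
        + volt (mulVecL2 S.A3 S.memLp_A3 x.1.fst) θ := by
  rw [psi_eq] at h2
  have h := congrArg (voltAt hθ) h2
  simp only [map_sub, map_add, map_neg, map_smul, voltAt_apply] at h
  -- The product rule produces `∫_0^θ A₂ z(-1)`, which cancels the integral of the last term of
  -- `psi_eq`.
  rw [volt_reflect_deriv z hθ, volt_convL_deriv S.memLp_A2 z hθ, volt_deriv _ _ hθ] at h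
  have e : H1.rep (S.rFun x) 0 = l • x.1.fst - H1.rep z (-1) := by rw [h1]; abel
  rw [e] at h
  rw [← sub_eq_zero] at h ⊢
  rw [← neg_eq_zero, ← h]
  abel

end Coeffs

/-! ### The bounded extension of `F⁻¹ (λ I - Ã)` and its invertibility -/

namespace Coeffs

variable (S : Coeffs 𝕜 n)

theorem integrated_equation_L2 {l : 𝕜} {x : S.domTilde} {z : H1 𝕜 n}
    (h1 : H1.rep z (-1) = l • x.1.fst - H1.rep (S.rFun x) 0)
    (h2 : S.psi z = l • x.1.snd
      - (-H1.deriv (S.rFun x) + mulVecL2 S.A3 S.memLp_A3 x.1.fst)) :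
    S.intOp (z : L2 𝕜 n) = constL2 (l • x.1.fst) - (S.rFun x : L2 𝕜 n)
      + voltL 𝕜 n (mulVecL2 S.A3 S.memLp_A3 x.1.fst - l • x.1.snd) := by
  have e1 : S.intOp (z : L2 𝕜 n) = reflect 𝕜 n (z : L2 𝕜 n)
      + convL S.A2 S.memLp_A2 (z : L2 𝕜 n)
      - voltL 𝕜 n (convL S.A3 S.memLp_A3 (z : L2 𝕜 n)) := rfl
  rw [e1]
  refine Lp.ext ?_
  filter_upwards [Lp.coeFn_sub (reflect 𝕜 n (z : L2 𝕜 n) + convL S.A2 S.memLp_A2 (z : L2 𝕜 n))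
      (voltL 𝕜 n (convL S.A3 S.memLp_A3 (z : L2 𝕜 n))),
    Lp.coeFn_add (reflect 𝕜 n (z : L2 𝕜 n)) (convL S.A2 S.memLp_A2 (z : L2 𝕜 n)),
    reflect_ae (z : L2 𝕜 n), measurePreserving_reflect.quasiMeasurePreserving.ae (H1.rep_ae_eq z),
    convL_ae S.A2 S.memLp_A2 (z : L2 𝕜 n), voltL_ae (convL S.A3 S.memLp_A3 (z : L2 𝕜 n)),
    Lp.coeFn_add (constL2 (l • x.1.fst) - (S.rFun x : L2 𝕜 n))
      (voltL 𝕜 n (mulVecL2 S.A3 S.memLp_A3 x.1.fst - l • x.1.snd)),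
    Lp.coeFn_sub (constL2 (l • x.1.fst)) (S.rFun x : L2 𝕜 n), constL2_ae (l • x.1.fst),
    H1.rep_ae_eq (S.rFun x), voltL_ae (mulVecL2 S.A3 S.memLp_A3 x.1.fst - l • x.1.snd),
    ae_restrict_mem measurableSet_Icc] with θ a1 a2 a3 a4 a5 a6 b1 b2 b3 b4 b5 hθ
  rw [a1, Pi.sub_apply, a2, Pi.add_apply, a3, a4, a5, a6, b1, Pi.add_apply, b2, Pi.sub_apply,
    b3, b4, b5, S.integrated_equation h1 h2 hθ, ← voltAt_apply hθ
      (mulVecL2 S.A3 S.memLp_A3 x.1.fst - l • x.1.snd), map_sub, map_smul, voltAt_apply,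
    voltAt_apply]
  abel

/-- A pair `(w, p)` solving the integrated eigenvalue equation is an eigenvector of `Ã`. -/
theorem exists_eigenvector {l : 𝕜} {w : E 𝕜 n} {p : L2 𝕜 n}
    (h1 : p + mulVecL2 S.A2 S.memLp_A2 w
      = constL2 (l • w) + voltL 𝕜 n (mulVecL2 S.A3 S.memLp_A3 w - l • p))
    (h2 : l • w + volt (mulVecL2 S.A3 S.memLp_A3 w - l • p) (-1) = act S.Am1 (l • w)) :
    ∃ x : S.Atilde.domain, x.1 = WithLp.toLp 2 (w, p) ∧ S.Atilde x = l • x.1 := by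
  set g := mulVecL2 S.A3 S.memLp_A3 w - l • p with hg
  -- The value at `-1` is chosen so that `r(0) = λ w`; with `r' = g = A₃ w - λ p` this is `Ã (w, p)
  -- = λ (w, p)`.
  set r := H1.equiv 𝕜 n (l • w - ∫ s in (-1 : ℝ)..0, g s, g) with hr
  have hrep : ∀ θ ∈ Icc (-1 : ℝ) 0, H1.rep r θ = l • w + volt g θ := fun θ hθ => by
    rw [hr, rep_equiv, volt_eq g hθ, prim, prim]
    abel
  have h0 : volt g 0 = 0 := intervalIntegral.integral_same
  have hcoe : (r : L2 𝕜 n) = p + mulVecL2 S.A2 S.memLp_A2 w := by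
    rw [h1]
    refine Lp.ext ?_
    filter_upwards [H1.rep_ae_eq r, Lp.coeFn_add (constL2 (l • w)) (voltL 𝕜 n g),
      constL2_ae (l • w), voltL_ae g, ae_restrict_mem measurableSet_Icc] with θ a1 a2 a3 a4 hθ
    rw [a1, a2, Pi.add_apply, a3, a4, hrep θ hθ]
  let x : S.domTilde := ⟨WithLp.toLp 2 (w, p), r, hcoe, by
    rw [hrep _ mem_left, hrep _ mem_right, h0, add_zero, h2]⟩
  have hx : S.rFun x = r := Subtype.ext hcoe.symm
  refine ⟨x, rfl, ?_⟩
  have e : S.Atilde x = WithLp.toLp 2 (H1.rep (S.rFun x) 0,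
    -H1.deriv (S.rFun x) + mulVecL2 S.A3 S.memLp_A3 w) := rfl
  rw [e, hx, hrep _ mem_right, h0, add_zero, hr, deriv_equiv, hg, neg_sub, sub_add_cancel]
  rfl

theorem ker_F : S.F.toFun.ker = ⊥ := LinearMap.ker_eq_bot.2 S.F_injective

theorem constL2_eq (c : E 𝕜 n) : constL2 c = Lp.constL 2 μ 𝕜 c := rfl

/-- The right-hand side of the integrated equation, as an operator on `w`. -/
def sourceOp (l : 𝕜) : E 𝕜 n →L[𝕜] L2 𝕜 n :=
  l • Lp.constL 2 μ 𝕜 - LinearMap.toContinuousLinearMap (mulVecL2 S.A2 S.memLp_A2)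
    + voltL 𝕜 n ∘L LinearMap.toContinuousLinearMap (mulVecL2 S.A3 S.memLp_A3)

/-- The dependence on `w` of the component `v` of `F⁻¹ (λ I - Ã) (w, ψ)`. -/
def boundaryOp (l : 𝕜) : E 𝕜 n →L[𝕜] E 𝕜 n :=
  l • ContinuousLinearMap.id 𝕜 (E 𝕜 n) - l • act S.Am1
    + voltAt mem_left ∘L LinearMap.toContinuousLinearMap (mulVecL2 S.A3 S.memLp_A3)

theorem sourceOp_apply (l : 𝕜) (w : E 𝕜 n) : S.sourceOp l w = constL2 (l • w)
    - mulVecL2 S.A2 S.memLp_A2 w + voltL 𝕜 n (mulVecL2 S.A3 S.memLp_A3 w) := by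
  rw [constL2_eq, map_smul]
  rfl

theorem boundaryOp_apply (l : 𝕜) (w : E 𝕜 n) : S.boundaryOp l w = l • w
    - l • act S.Am1 w + volt (mulVecL2 S.A3 S.memLp_A3 w) (-1) := rfl

/-- The integrated equation and its value at `θ = -1` are exactly the two relations of
`exists_equiv_of_triangular`. -/
theorem exists_extension {l : 𝕜} (hl : l ∈ resolventSet S.Atilde) :
    ∃ T : M2 𝕜 n ≃L[𝕜] M2 𝕜 n, ∀ (x : S.Atilde.domain) (y : S.F.domain),
      S.F y = l • (x : M2 𝕜 n) - S.Atilde x → T x = y := by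
  obtain ⟨R, hR, -⟩ := hl
  -- These are the two relations with `z = 0` and `v = 0`; they make `(w, p)` a solution of `Ã x = λ
  -- x`.
  have hker : ∀ w p, ((1 : L2 𝕜 n →L[𝕜] L2 𝕜 n) + l • voltL 𝕜 n) p = S.sourceOp l w →
      S.boundaryOp l w + (-(l • voltAt mem_left) : L2 𝕜 n →L[𝕜] E 𝕜 n) p = 0 → w = 0 := by
    intro w p hU hD
    change p + l • voltL 𝕜 n p = _ at hU
    change _ + -(l • volt p (-1)) = 0 at hD
    rw [sourceOp_apply] at hU
    rw [boundaryOp_apply] at hD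
    obtain ⟨x, hx, hA⟩ := S.exists_eigenvector (l := l) (w := w) (p := p) (by
      rw [map_sub, map_smul]
      rw [← sub_eq_zero] at hU ⊢
      rw [← hU]
      abel) (by
      rw [← voltAt_apply mem_left, map_sub, map_smul, map_smul, voltAt_apply, voltAt_apply]
      rw [← sub_eq_zero, ← hD]
      abel)
    have h := hR x
    rw [hA, sub_self, map_zero, hx] at h
    exact (congrArg WithLp.fst h).symm
  obtain ⟨T, hT⟩ := exists_equiv_of_triangular S.intOp_bijective
    (isVolterra_voltL.smul l).bijective_one_add (S.sourceOp l) (S.boundaryOp l)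
    (-(l • voltAt mem_left))
    (voltAt mem_left ∘L convL S.A3 S.memLp_A3 - convAt S.A2 S.memLp_A2 mem_left) hker
  refine ⟨T, fun x y hy => ?_⟩
  have h1 : H1.rep (S.zFun y) (-1) = l • x.1.fst - H1.rep (S.rFun x) 0 :=
    congrArg WithLp.fst hy
  have h2 : S.psi (S.zFun y) = l • x.1.snd
      - (-H1.deriv (S.rFun x) + mulVecL2 S.A3 S.memLp_A3 x.1.fst) := congrArg WithLp.snd hy
  have hr : (S.rFun x : L2 𝕜 n) = x.1.snd + mulVecL2 S.A2 S.memLp_A2 x.1.fst := rfl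
  have hbd : H1.rep (S.rFun x) (-1) = act S.Am1 (H1.rep (S.rFun x) 0) := by
    obtain ⟨r, hr', h⟩ := x.2
    have : S.rFun x = r := Subtype.ext hr'.symm
    rw [this, h]
  refine hT x y.1.fst y.1.snd ?_ ?_
  · refine (S.integrated_equation_L2 h1 h2).trans ?_
    rw [hr, sourceOp_apply, map_sub, map_smul]
    change _ = _ - (x.1.snd + l • voltL 𝕜 n x.1.snd)
    abel
  -- At `θ = -1` the leading term is `z(0)`. The term `A₋₁ r(0)` from `r(-1)` cancels against the
  -- one in `A₋₁ z(-1) = A₋₁ (λ w - r(0))`.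
  · have h3 := S.integrated_equation h1 h2 mem_left
    have e0 : (-(-1 : ℝ) - 1) = 0 := by norm_num
    rw [e0, hbd] at h3
    rw [S.fst_eq y, h1, boundaryOp_apply, map_sub, map_smul]
    change _ = _ + -(l • volt x.1.snd (-1))
      + (volt (convL S.A3 S.memLp_A3 (S.zFun y : L2 𝕜 n)) (-1)
        - conv S.A2 (S.zFun y : L2 𝕜 n) (-1))
    rw [← sub_eq_zero] at h3 ⊢
    rw [← h3]
    abel

end Coeffs

end NeutralSystem

end

theorem mainTheorem4 {𝕜 : Type*} [RCLike 𝕜] (n : ℕ) (S : NeutralSystem.Coeffs 𝕜 n) (l : 𝕜)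
    (hl : l ∉ NeutralSystem.spectrum S.Atilde) :
    -- `F : D(𝒜) → M₂` is bijective, so that `F⁻¹ : M₂ → D(𝒜)` makes sense
    Function.Bijective S.F ∧
    -- `F⁻¹ (λ I - Ã)`, defined on `D(Ã)`, extends to a bounded and boundedly invertible operator
    ∃ T : NeutralSystem.M2 𝕜 n ≃L[𝕜] NeutralSystem.M2 𝕜 n,
      ∀ x : S.Atilde.domain,
        ∃ h : l • (x : NeutralSystem.M2 𝕜 n) - S.Atilde x ∈ S.F.inverse.domain,
          T x = S.F.inverse ⟨l • (x : NeutralSystem.M2 𝕜 n) - S.Atilde x, h⟩ := by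
  obtain ⟨T, hT⟩ := S.exists_extension (not_not.1 hl)
  refine ⟨⟨S.F_injective, S.F_surjective⟩, T, fun x => ?_⟩
  obtain ⟨y, hy⟩ := S.F_surjective (l • (x : NeutralSystem.M2 𝕜 n) - S.Atilde x)
  refine ⟨?_, ?_⟩
  · rw [LinearPMap.inverse_domain]
    exact ⟨y, hy⟩
  -- `LinearPMap.inverse` is a genuine inverse only when the kernel is trivial, which `ker_F`
  -- provides.
  · rw [LinearPMap.inverse_apply_eq S.ker_F hy]
    exact hT x y hy
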